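/- Let $X=(X_1,\dots,X_N)$ and $Y=(Y_1,\dots,Y_N)$ have finite alphabets and joint law $P_{XY}(x,y)=\prod_{i=1}^N P_{X_iY_i}(x_i,y_i)$, with $H(X_i)>0$ for every $i$. For $j=1,\dots,K$ let $C_j=(Y_i)_{i\in S_j}$, $S_j\subseteq\{1,\dots,N\}$, be the sub-vector of $Y$ demanded by user $j$, and let $\lambda_j\ge 0$. All logarithms are natural. For $0\le\epsilon<I(X;Y)$ put $$h_\epsilon^K(P_{XY})=\sup_{P_{U|Y,X}:\ I(X;U)\le\epsilon}\ \sum_{j=1}^K\lambda_j I(C_j;U),$$ the supremum being over all conditional laws of a random variable $U$ with a finite alphabet. Put $\mu_i=\sum_{j:\,i\in S_j}\lambda_j$, $\alpha_i=\epsilon_i/H(X_i)$, $$\beta_i=H(Y_i|X_i)-\alpha_iH(X_i|Y_i)+\epsilon_i-(1-\alpha_i)\bigl(\log(I(X_i;Y_i)+1)+4\bigr),$$ $$\gamma_i=1-\frac{H(X_i|Y_i)}{H(X_i)}+\frac{\log(I(X_i;Y_i)+1)+4}{H(X_i)},$$ $$L_\epsilon^2=\sum_{i=1}^N\mu_i\bigl(H(Y_i|X_i)-(\log(I(X_i;Y_i)+1)+4)\bigr)+\epsilon\,\max_i\{\mu_i\gamma_i\}.$$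 Then: (1) $\displaystyle h_\epsilon^K(P_{XY})\ \ge\ \sup\Bigl\{\sum_{i=1}^N\mu_i\beta_i:\ 0\le\epsilon_i\le\min\{\epsilon,H(X_i)\},\ \sum_{i=1}^N\epsilon_i\le\epsilon\Bigr\}.$ (2) The objective is affine in $(\epsilon_1,\dots,\epsilon_N)$, namely $$\sum_i\mu_i\beta_i=\sum_i\mu_i\bigl(H(Y_i|X_i)-(\log(I(X_i;Y_i)+1)+4)\bigr)+\sum_i\mu_i\gamma_i\epsilon_i,$$ and the linear program without the constraints $\epsilon_i\le H(X_i)$ has the value $$\sup\Bigl\{\sum_{i=1}^N\mu_i\beta_i:\ 0\le\epsilon_i\le\epsilon,\ \sum_{i=1}^N\epsilon_i\le\epsilon\Bigr\}=L_\epsilon^2.$$ (3) Let $M$ be the set of the indices $i$ at which $\mu_i\gamma_i$ is maximal. If $\epsilon\le\sum_{i\in M}H(X_i)$ (for instance, if $\epsilon\le H(X_i)$ for some $i\in M$), then the suprema in (1) and (2) are equal, so that $$h_\epsilon^K(P_{XY})\ \ge\ \sup\Bigl\{\sum_{i=1}^N\mu_i\beta_i:\ 0\le\epsilon_i\le\epsilon,\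 \sum_{i=1}^N\epsilon_i\le\epsilon\Bigr\}=L_\epsilon^2.$$ -/

import Mathlib

open scoped BigOperators

namespace PrivacyUtility

noncomputable section

/-! ### Shannon quantities of random variables on a finite probability space

A probability mass function on a finite type `Ω` is an element `p` of `stdSimplex ℝ Ω`, and a random
variable is a function `f : Ω → A` with values in a finite alphabet. Logarithms are natural. -/

section Shannon

variable {Ω A B : Type*} [Fintype Ω] [Fintype A] [Fintype B]

open Classical in
/-- The law of the random variable `f`: `P_f(a) = P(f = a)`. -/
def law (p : Ω → ℝ) (f : Ω → A) (a : A) : ℝ :=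
  ∑ ω : Ω, if f ω = a then p ω else 0

/-- Shannon entropy `H(f) = - ∑ a, P_f(a) log P_f(a)`, in nats. -/
def entropy (p : Ω → ℝ) (f : Ω → A) : ℝ :=
  ∑ a : A, Real.negMulLog (law p f a)

/-- Conditional entropy `H(f | g) = H(f, g) - H(g)`. -/
def condEntropy (p : Ω → ℝ) (f : Ω → A) (g : Ω → B) : ℝ :=
  entropy p (fun ω => (f ω, g ω)) - entropy p g

/-- Mutual information `I(f ; g) = H(f) + H(g) - H(f, g)`. -/
def mutualInfo (p : Ω → ℝ) (f : Ω → A) (g : Ω → B) : ℝ :=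
  entropy p f + entropy p g - entropy p (fun ω => (f ω, g ω))

end Shannon

/-! ### The privacy problem

The sample space is `((i : Fin N) → 𝒳 i) × ((i : Fin N) → 𝒴 i)`; a point of it is a pair
`(x, y)` of vectors, and a mass function `P` on it is the joint law `P_{XY}` of the private data
`X = (X_1, …, X_N)` and the useful data `Y = (Y_1, …, Y_N)`. -/

section Problem

variable {N K : ℕ} {𝒳 𝒴 : Fin N → Type*} [∀ i, Fintype (𝒳 i)] [∀ i, Fintype (𝒴 i)]

/-- The coordinate `X_i`. -/
def coordX (i : Fin N) (ω : ((i : Fin N) → 𝒳 i) × ((i : Fin N) → 𝒴 i)) : 𝒳 i := ω.1 i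

/-- The coordinate `Y_i`. -/
def coordY (i : Fin N) (ω : ((i : Fin N) → 𝒳 i) × ((i : Fin N) → 𝒴 i)) : 𝒴 i := ω.2 i

/-- The sub-vector `(Y_i)_{i ∈ s}` of the useful data. -/
def subvector (s : Finset (Fin N)) (ω : ((i : Fin N) → 𝒳 i) × ((i : Fin N) → 𝒴 i)) :
    (i : {i // i ∈ s}) → 𝒴 i.1 := fun i => ω.2 i.1

/-- `P_{XY}(x, y) = ∏ i, P_{X_i Y_i}(x_i, y_i)`: the pairs `(X_i, Y_i)` are mutually independent. -/
def IndepPairs (P : ((i : Fin N) → 𝒳 i) × ((i : Fin N) → 𝒴 i) → ℝ) : Prop :=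
  ∀ (x : (i : Fin N) → 𝒳 i) (y : (i : Fin N) → 𝒴 i),
    P (x, y) = ∏ i : Fin N, law P (fun ω => (coordX i ω, coordY i ω)) (x i, y i)

/-- The joint law of `((X, Y), U)` when `U` is drawn from the conditional law `W = P_{U|X,Y}`. -/
def jointLaw {n : ℕ} (P : ((i : Fin N) → 𝒳 i) × ((i : Fin N) → 𝒴 i) → ℝ)
    (W : ((i : Fin N) → 𝒳 i) × ((i : Fin N) → 𝒴 i) → Fin n → ℝ) :
    (((i : Fin N) → 𝒳 i) × ((i : Fin N) → 𝒴 i)) × Fin n → ℝ :=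
  fun t => P t.1 * W t.1 t.2

/-- The leakage `I(X ; U)`. -/
def leakage {n : ℕ} (P : ((i : Fin N) → 𝒳 i) × ((i : Fin N) → 𝒴 i) → ℝ)
    (W : ((i : Fin N) → 𝒳 i) × ((i : Fin N) → 𝒴 i) → Fin n → ℝ) : ℝ :=
  mutualInfo (jointLaw P W) (fun t => t.1.1) (fun t => t.2)

/-- The weighted sum-utility `∑ j, λ_j I(C_j ; U)`, where user `j` demands `C_j = (Y_i)_{i ∈ S j}`. -/
def utility {n : ℕ} (P : ((i : Fin N) → 𝒳 i) × ((i : Fin N) → 𝒴 i) → ℝ)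
    (S : Fin K → Finset (Fin N)) (lam : Fin K → ℝ)
    (W : ((i : Fin N) → 𝒳 i) × ((i : Fin N) → 𝒴 i) → Fin n → ℝ) : ℝ :=
  ∑ j : Fin K, lam j *
    mutualInfo (jointLaw P W) (fun t => subvector (S j) t.1) (fun t => t.2)

/-- `h_ε^K(P_{XY})`: the supremum of the weighted sum-utility over all conditional laws `P_{U|X,Y}`
on finite alphabets with `I(X ; U) ≤ ε`. -/
def privacyUtility (P : ((i : Fin N) → 𝒳 i) × ((i : Fin N) → 𝒴 i) → ℝ)
    (S : Fin K → Finset (Fin N)) (lam : Fin K → ℝ) (ε : ℝ) : ℝ :=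
  sSup {v : ℝ | ∃ (n : ℕ) (W : ((i : Fin N) → 𝒳 i) × ((i : Fin N) → 𝒴 i) → Fin n → ℝ),
    (∀ ω, W ω ∈ stdSimplex ℝ (Fin n)) ∧ leakage P W ≤ ε ∧ v = utility P S lam W}

/-! ### The quantities in the lower bound -/

/-- `μ_i = ∑_{j : Y_i ∈ C_j} λ_j`. -/
def weight (S : Fin K → Finset (Fin N)) (lam : Fin K → ℝ) (i : Fin N) : ℝ :=
  ∑ j : Fin K with i ∈ S j, lam j

/-- `log (I(X_i ; Y_i) + 1) + 4`. -/
def excess (P : ((i : Fin N) → 𝒳 i) × ((i : Fin N) → 𝒴 i) → ℝ) (i : Fin N) : ℝ :=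
  Real.log (mutualInfo P (coordX i) (coordY i) + 1) + 4

/-- `α_i = ε_i / H(X_i)`. -/
def alpha (P : ((i : Fin N) → 𝒳 i) × ((i : Fin N) → 𝒴 i) → ℝ) (i : Fin N) (e : ℝ) : ℝ :=
  e / entropy P (coordX i)

/-- `β_i = H(Y_i|X_i) - α_i H(X_i|Y_i) + ε_i - (1 - α_i) (log (I(X_i;Y_i) + 1) + 4)`. -/
def beta (P : ((i : Fin N) → 𝒳 i) × ((i : Fin N) → 𝒴 i) → ℝ) (i : Fin N) (e : ℝ) : ℝ :=
  condEntropy P (coordY i) (coordX i) - alpha P i e * condEntropy P (coordX i) (coordY i) + e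
    - (1 - alpha P i e) * excess P i

/-- `γ_i = 1 - H(X_i|Y_i) / H(X_i) + (log (I(X_i;Y_i) + 1) + 4) / H(X_i)`. -/
def gamma (P : ((i : Fin N) → 𝒳 i) × ((i : Fin N) → 𝒴 i) → ℝ) (i : Fin N) : ℝ :=
  1 - condEntropy P (coordX i) (coordY i) / entropy P (coordX i)
    + excess P i / entropy P (coordX i)

/-- `max_i μ_i γ_i`. -/
def maxCoeff (P : ((i : Fin N) → 𝒳 i) × ((i : Fin N) → 𝒴 i) → ℝ)
    (S : Fin K → Finset (Fin N)) (lam : Fin K → ℝ) : ℝ :=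
  ⨆ i : Fin N, weight S lam i * gamma P i

/-- The constant term `∑ i, μ_i (H(Y_i|X_i) - (log (I(X_i;Y_i) + 1) + 4))`. -/
def constTerm (P : ((i : Fin N) → 𝒳 i) × ((i : Fin N) → 𝒴 i) → ℝ)
    (S : Fin K → Finset (Fin N)) (lam : Fin K → ℝ) : ℝ :=
  ∑ i : Fin N, weight S lam i * (condEntropy P (coordY i) (coordX i) - excess P i)

/-- `L_ε^2`. -/
def lowerBound (P : ((i : Fin N) → 𝒳 i) × ((i : Fin N) → 𝒴 i) → ℝ)
    (S : Fin K → Finset (Fin N)) (lam : Fin K → ℝ) (ε : ℝ) : ℝ :=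
  constTerm P S lam + maxCoeff P S lam * ε

/-- The objective `∑ i, μ_i β_i` as a function of `(ε_1, …, ε_N)`. -/
def objective (P : ((i : Fin N) → 𝒳 i) × ((i : Fin N) → 𝒴 i) → ℝ)
    (S : Fin K → Finset (Fin N)) (lam : Fin K → ℝ) (e : Fin N → ℝ) : ℝ :=
  ∑ i : Fin N, weight S lam i * beta P i (e i)

/-- The leakage allocations: `0 ≤ ε_i ≤ ε` and `∑ i, ε_i ≤ ε`. -/
def allocations (N : ℕ) (ε : ℝ) : Set (Fin N → ℝ) :=
  {e | (∀ i, 0 ≤ e i ∧ e i ≤ ε) ∧ ∑ i, e i ≤ ε}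

/-- The allocations in which no `ε_i` exceeds `H(X_i)`, that is `α_i ≤ 1` for all `i`. -/
def properAllocations (P : ((i : Fin N) → 𝒳 i) × ((i : Fin N) → 𝒴 i) → ℝ) (ε : ℝ) :
    Set (Fin N → ℝ) :=
  {e | e ∈ allocations N ε ∧ ∀ i, e i ≤ entropy P (coordX i)}

end Problem

end

end PrivacyUtility

/-!
The utility side of the bound is a statement about one pair `(X, Y)` at a time. For a single pair
there is an output `U₀` which is independent of `X` and satisfies
`H(Y | U₀) ≤ I(X ; Y) + log (I(X ; Y) + 1) + 4`, that is
`I(Y ; U₀) ≥ H(Y | X) - (log (I(X ; Y) + 1) + 4)` (`exists_private_channel`). Disclosing `Y` itself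
instead leaks `I(X ; Y) ≤ H(X)` and has the utility `H(Y)`. If the second channel is used with
probability `α = e / H(X)`, the first one otherwise, and the choice is announced, then both mutual
informations are the corresponding averages (`mutualInfo_mixChannel`): the leakage is at most `e`
and the utility at least `β` (`exists_channel`). Such channels used side by side on independent
pairs have additive leakages and utilities (`mutualInfo_productChannel`), which proves the bound for
each proper allocation. What remains is a linear program with nonnegative coefficients, solved by
spending the whole leakage on components with the largest coefficient.

The output `U₀` is a strong functional representation with a finite alphabet. It consists of `T`
proposals, i.i.d. with the law `Q` of `Y` and independent of `X`. Given `X = x`, greedy rejection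
sampling with the target `R = P_{Y|X=x}` picks one of the proposals as `Y`, or, when it has
rejected all of them, draws `Y` from what is left of the target. The index `k` of a proposal
accepted with the value `b` satisfies `k + 1 ≤ (1 + R b / Q b) / r`, with `r` the probability that
the proposals before it are rejected; therefore the number of proposals has an expected logarithm
of at most `D(R ‖ Q) + log 2 + 1` (`expected_log_le`). Given the proposals, `Y` is described by
this number. A code for the integers with weights proportional to `(k + 1) ^ (-(1 + θ))`, for the
right `θ`, turns the bound on the expected logarithm, averaged over `x`, into the bound on
`H(Y | U₀)` by Gibbs' inequality (`condEntropy_le_cross`). The event that all proposals are rejected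
needs a description of `Y` itself, but its probability is of the order of `1 / T`, and the
constant `4` leaves room for its cost.
-/

namespace PrivacyUtility

section Shannon

/-! ### Laws and entropies of random variables -/

variable {Ω Ω' A B C : Type*} [Fintype Ω]

lemma law_nonneg {p : Ω → ℝ} (hp : ∀ ω, 0 ≤ p ω) (f : Ω → A) (a : A) : 0 ≤ law p f a := by
  classical
  exact Finset.sum_nonneg fun ω _ => by split_ifs <;> simp [hp]

lemma sum_law_mul [Fintype A] (p : Ω → ℝ) (f : Ω → A) (F : A → ℝ) :
    ∑ a, law p f a * F a = ∑ ω, p ω * F (f ω) := by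
  classical
  simp only [law, Finset.sum_mul, ite_mul, zero_mul]
  rw [Finset.sum_comm]
  exact Finset.sum_congr rfl fun ω _ => by simp

lemma sum_law [Fintype A] (p : Ω → ℝ) (f : Ω → A) : ∑ a, law p f a = ∑ ω, p ω := by
  simpa using sum_law_mul p f fun _ => 1

lemma law_comp [Fintype A] (p : Ω → ℝ) (f : Ω → A) (g : A → B) :
    law p (fun ω => g (f ω)) = law (law p f) g := by
  classical
  funext b
  have := sum_law_mul p f fun a => if g a = b then 1 else 0
  simp only [mul_ite, mul_one, mul_zero] at this
  simp only [law] at this ⊢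
  rw [← this]

lemma law_equiv [Fintype Ω'] (φ : Ω' ≃ Ω) (p : Ω → ℝ) (f : Ω → A) :
    law (fun ω => p (φ ω)) (fun ω => f (φ ω)) = law p f := by
  classical
  funext a
  exact φ.sum_comp fun ω => if f ω = a then p ω else 0

lemma law_id (p : Ω → ℝ) : law p (fun ω => ω) = p := by
  classical
  funext ω
  simp [law]

lemma law_injective_apply (p : Ω → ℝ) {g : Ω → B} (hg : Function.Injective g) (ω : Ω) :
    law p g (g ω) = p ω := by
  classical
  simp [law, hg.eq_iff]

lemma law_eq_zero (p : Ω → ℝ) {g : Ω → B} {b : B} (hb : ∀ ω, g ω ≠ b) : law p g b = 0 := by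
  classical
  simp [law, hb]

lemma le_law {p : Ω → ℝ} (hp : ∀ ω, 0 ≤ p ω) (f : Ω → A) (ω : Ω) : p ω ≤ law p f (f ω) := by
  classical
  have := Finset.single_le_sum (f := fun ω' => if f ω' = f ω then p ω' else 0)
    (fun ω' _ => by split_ifs <;> simp [hp]) (Finset.mem_univ ω)
  simpa [law] using this

variable [Fintype Ω'] [Fintype A] [Fintype B] [Fintype C]

lemma law_mem_stdSimplex {p : Ω → ℝ} (hp : p ∈ stdSimplex ℝ Ω) (f : Ω → A) :
    law p f ∈ stdSimplex ℝ A :=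
  ⟨law_nonneg hp.1 f, (sum_law p f).trans hp.2⟩

lemma entropy_equiv (φ : Ω' ≃ Ω) (p : Ω → ℝ) (f : Ω → A) :
    entropy (fun ω => p (φ ω)) (fun ω => f (φ ω)) = entropy p f := by
  rw [entropy, law_equiv, entropy]

lemma entropy_comp (p : Ω → ℝ) (f : Ω → A) (g : A → B) :
    entropy p (fun ω => g (f ω)) = entropy (law p f) g := by
  rw [entropy, law_comp, entropy]

lemma entropy_injective (p : Ω → ℝ) {g : Ω → B} (hg : Function.Injective g) :
    entropy p g = ∑ ω, Real.negMulLog (p ω) := by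
  classical
  have h : ∑ b ∈ Finset.univ.image g, Real.negMulLog (law p g b) = entropy p g := by
    refine Finset.sum_subset (Finset.subset_univ _) fun b _ hb => ?_
    rw [law_eq_zero p (b := b) (by simpa using hb), Real.negMulLog_zero]
  rw [← h, Finset.sum_image fun _ _ _ _ h => hg h]
  simp [law_injective_apply p hg]

/-- Entropy only depends on the partition of the sample space defined by a random variable. -/
lemma entropy_comp_injective (p : Ω → ℝ) (f : Ω → A) {g : A → B} (hg : Function.Injective g) :
    entropy p (fun ω => g (f ω)) = entropy p f := by
  rw [entropy_comp, entropy_injective _ hg, entropy]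

lemma entropy_const (p : Ω → ℝ) (hp : ∑ ω, p ω = 1) (b : B) : entropy p (fun _ => b) = 0 := by
  classical
  refine Finset.sum_eq_zero fun b' _ => ?_
  by_cases h : b = b' <;> simp [law, h, hp]

/-- Entropy written as an expectation over the sample space. -/
lemma entropy_eq_sum (p : Ω → ℝ) (f : Ω → A) :
    entropy p f = -∑ ω, p ω * Real.log (law p f (f ω)) := by
  rw [← sum_law_mul p f fun a => Real.log (law p f a), ← Finset.sum_neg_distrib]
  simp [entropy, Real.negMulLog]

/-- A function of a random variable has at most the entropy of that variable. -/
lemma entropy_comp_le {p : Ω → ℝ} (hp : ∀ ω, 0 ≤ p ω) (f : Ω → A) (g : A → B) :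
    entropy p (fun ω => g (f ω)) ≤ entropy p f := by
  rw [entropy_eq_sum, entropy_eq_sum, neg_le_neg_iff]
  refine Finset.sum_le_sum fun ω _ => ?_
  rcases (hp ω).eq_or_lt with h | h
  · simp [← h]
  · have h1 : 0 < law p f (f ω) := h.trans_le (le_law hp f ω)
    refine mul_le_mul_of_nonneg_left (Real.log_le_log h1 ?_) h.le
    rw [law_comp p f g]
    exact le_law (law_nonneg hp f) g (f ω)

lemma mutualInfo_le_entropy_left {p : Ω → ℝ} (hp : ∀ ω, 0 ≤ p ω) (f : Ω → A) (g : Ω → B) :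
    mutualInfo p f g ≤ entropy p f := by
  have := entropy_comp_le hp (fun ω => (f ω, g ω)) Prod.snd
  simp only [mutualInfo] at this ⊢
  linarith

lemma entropy_pair_self (p : Ω → ℝ) (f : Ω → A) : entropy p (fun ω => (f ω, f ω)) = entropy p f :=
  entropy_comp_injective p f (g := fun a => (a, a)) fun _ _ h => (Prod.ext_iff.1 h).1

lemma mutualInfo_self (p : Ω → ℝ) (f : Ω → A) : mutualInfo p f f = entropy p f := by
  rw [mutualInfo, entropy_pair_self]; ring

lemma mutualInfo_const_left (p : Ω → ℝ) (hp : ∑ ω, p ω = 1) (a : A) (g : Ω → B) :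
    mutualInfo p (fun _ => a) g = 0 := by
  have h : entropy p (fun ω => (a, g ω)) = entropy p g :=
    entropy_comp_injective p g (g := fun b => (a, b)) fun _ _ h => (Prod.ext_iff.1 h).2
  rw [mutualInfo, entropy_const p hp, h]; ring

lemma mutualInfo_comp_injective (p : Ω → ℝ) (f : Ω → A) (g : Ω → B) {A' B' : Type*} [Fintype A']
    [Fintype B'] {h : A → A'} {k : B → B'} (hh : Function.Injective h)
    (hk : Function.Injective k) :
    mutualInfo p (fun ω => h (f ω)) (fun ω => k (g ω)) = mutualInfo p f g := by
  have h1 : entropy p (fun ω => (h (f ω), k (g ω))) = entropy p (fun ω => (f ω, g ω)) :=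
    entropy_comp_injective p (fun ω => (f ω, g ω)) (g := Prod.map h k) (hh.prodMap hk)
  rw [mutualInfo, mutualInfo, entropy_comp_injective p f hh, entropy_comp_injective p g hk, h1]

lemma mutualInfo_equiv (φ : Ω' ≃ Ω) (p : Ω → ℝ) (f : Ω → A) (g : Ω → B) :
    mutualInfo (fun ω => p (φ ω)) (fun ω => f (φ ω)) (fun ω => g (φ ω)) = mutualInfo p f g := by
  rw [mutualInfo, mutualInfo, entropy_equiv φ, entropy_equiv φ,
    entropy_equiv φ p fun ω => (f ω, g ω)]

lemma mutualInfo_comp (p : Ω → ℝ) (f : Ω → A) (g : A → B) (h : A → C) :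
    mutualInfo p (fun ω => g (f ω)) (fun ω => h (f ω)) = mutualInfo (law p f) g h := by
  rw [mutualInfo, mutualInfo, entropy_comp p f g, entropy_comp p f h,
    entropy_comp p f fun a => (g a, h a)]

/-- Gibbs' inequality: the conditional entropy of `f` given `g` is at most the expected length of
any conditional code `q`. The hypothesis `hpos` asks that the code assigns a positive weight to
every value which occurs. -/
lemma condEntropy_le_cross {p : Ω → ℝ} (hp : ∀ ω, 0 ≤ p ω) (f : Ω → A) (g : Ω → B)
    (q : A → B → ℝ) (hq : ∀ a b, 0 ≤ q a b) (hq1 : ∀ b, ∑ a, q a b ≤ 1)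
    (hpos : ∀ ω, 0 < p ω → 0 < q (f ω) (g ω)) :
    condEntropy p f g ≤ -∑ ω, p ω * Real.log (q (f ω) (g ω)) := by
  set j := law p fun ω => (f ω, g ω) with hj
  have hj0 : ∀ z, 0 ≤ j z := law_nonneg hp _
  have hm : law p g = law j Prod.snd := law_comp p (fun ω => (f ω, g ω)) Prod.snd
  have key : ∀ ω, p ω * (Real.log (law p g (g ω)) - Real.log (j (f ω, g ω)) +
      Real.log (q (f ω) (g ω))) ≤
      p ω * (law p g (g ω) * q (f ω) (g ω) / j (f ω, g ω) - 1) := by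
    intro ω
    rcases (hp ω).eq_or_lt with h | h
    · simp [← h]
    · have h1 : 0 < law p g (g ω) := h.trans_le (le_law hp g ω)
      have h2 : 0 < j (f ω, g ω) := h.trans_le (le_law hp (fun ω => (f ω, g ω)) ω)
      have h3 := hpos ω h
      refine mul_le_mul_of_nonneg_left ?_ h.le
      rw [← Real.log_div h1.ne' h2.ne', ← Real.log_mul (by positivity) h3.ne', div_mul_eq_mul_div]
      exact Real.log_le_sub_one_of_pos (by positivity)
  have hs : ∑ ω, p ω * (law p g (g ω) * q (f ω) (g ω) / j (f ω, g ω)) ≤ ∑ ω, p ω := by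
    rw [← sum_law_mul p (fun ω => (f ω, g ω)) fun z => law p g z.2 * q z.1 z.2 / j z,
      Fintype.sum_prod_type_right, ← sum_law p g]
    refine Finset.sum_le_sum fun b _ => ?_
    calc ∑ a, j (a, b) * (law p g b * q a b / j (a, b))
        ≤ ∑ a, law p g b * q a b := by
          refine Finset.sum_le_sum fun a _ => ?_
          rcases (hj0 (a, b)).eq_or_lt with h | h
          · rw [← h]; simpa using mul_nonneg (law_nonneg hp g b) (hq a b)
          · rw [mul_div_cancel₀ _ h.ne']
      _ = law p g b * ∑ a, q a b := by rw [Finset.mul_sum]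
      _ ≤ law p g b := mul_le_of_le_one_right (law_nonneg hp g b) (hq1 b)
  have := Finset.sum_le_sum fun ω (_ : ω ∈ Finset.univ) => key ω
  simp only [mul_sub, mul_add, Finset.sum_add_distrib, Finset.sum_sub_distrib, mul_one] at this
  rw [condEntropy, entropy_eq_sum, entropy_eq_sum]
  linarith

lemma mutualInfo_nonneg {p : Ω → ℝ} (hp : p ∈ stdSimplex ℝ Ω) (f : Ω → A) (g : Ω → B) :
    0 ≤ mutualInfo p f g := by
  have h := condEntropy_le_cross hp.1 f g (fun a _ => law p f a) (fun a _ => law_nonneg hp.1 f a)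
    (fun _ => by rw [sum_law, hp.2]) (fun ω h => h.trans_le (le_law hp.1 f ω))
  rw [← entropy_eq_sum, condEntropy] at h
  rw [mutualInfo]
  linarith

/-! ### Products of independent random variables -/

/-- Leibniz rule for `negMulLog`. It needs no positivity, since `negMulLog 0 = 0`. -/
lemma negMulLog_prod {ι : Type*} [DecidableEq ι] (s : Finset ι) (x : ι → ℝ) :
    Real.negMulLog (∏ i ∈ s, x i) =
      ∑ i ∈ s, ∏ j ∈ s, if j = i then Real.negMulLog (x j) else x j := by
  induction s using Finset.induction_on with
  | empty => simp
  | insert a s ha ih =>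
    have h1 : ∀ i ∈ s, (∏ j ∈ insert a s, if j = i then Real.negMulLog (x j) else x j) =
        x a * ∏ j ∈ s, if j = i then Real.negMulLog (x j) else x j := fun i hi => by
      rw [Finset.prod_insert ha, if_neg (ne_of_mem_of_not_mem hi ha).symm]
    have h2 : (∏ j ∈ s, if j = a then Real.negMulLog (x j) else x j) = ∏ j ∈ s, x j :=
      Finset.prod_congr rfl fun j hj => if_neg (ne_of_mem_of_not_mem hj ha)
    rw [Finset.prod_insert ha, Real.negMulLog_mul, ih, Finset.sum_insert ha,
      Finset.sum_congr rfl h1, Finset.prod_insert ha, if_pos rfl, h2, Finset.mul_sum]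
    ring

variable {ι : Type*} [Fintype ι] [DecidableEq ι] {Ω₁ A₁ B₁ : ι → Type*} [∀ i, Fintype (Ω₁ i)]

lemma sum_pi_prod [∀ i, Fintype (A₁ i)] (q : ∀ i, A₁ i → ℝ) :
    ∑ a : ∀ i, A₁ i, ∏ i, q i (a i) = ∏ i, ∑ a, q i a := by
  rw [Finset.prod_univ_sum, Fintype.piFinset_univ]

lemma law_pi (p : ∀ i, Ω₁ i → ℝ) (f : ∀ i, Ω₁ i → A₁ i) (a : ∀ i, A₁ i) :
    law (fun ω : ∀ i, Ω₁ i => ∏ i, p i (ω i)) (fun (ω : ∀ i, Ω₁ i) i => f i (ω i)) a =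
      ∏ i, law (p i) (f i) (a i) := by
  classical
  simp only [law]
  rw [← sum_pi_prod fun i ω => if f i ω = a i then p i ω else 0]
  refine Finset.sum_congr rfl fun ω _ => ?_
  rw [Finset.prod_ite_zero]
  simp [funext_iff]

variable [∀ i, Fintype (A₁ i)] [∀ i, Fintype (B₁ i)]

lemma sum_negMulLog_pi (q : ∀ i, A₁ i → ℝ) (hq : ∀ i, ∑ a, q i a = 1) :
    ∑ a : ∀ i, A₁ i, Real.negMulLog (∏ i, q i (a i)) = ∑ i, ∑ a, Real.negMulLog (q i a) := by
  simp_rw [negMulLog_prod]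
  rw [Finset.sum_comm]
  refine Finset.sum_congr rfl fun i _ => ?_
  rw [sum_pi_prod fun j a => if j = i then Real.negMulLog (q j a) else q j a,
    Finset.prod_eq_single i]
  · simp
  · intro j _ hj
    simp [hj, hq]
  · simp

/-- The entropies of independent random variables add up. -/
lemma entropy_pi (p : ∀ i, Ω₁ i → ℝ) (hp : ∀ i, ∑ ω, p i ω = 1) (f : ∀ i, Ω₁ i → A₁ i) :
    entropy (fun ω : ∀ i, Ω₁ i => ∏ i, p i (ω i)) (fun (ω : ∀ i, Ω₁ i) i => f i (ω i)) =
      ∑ i, entropy (p i) (f i) := by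
  simp only [entropy, law_pi]
  exact sum_negMulLog_pi _ fun i => by rw [sum_law, hp]

/-- Mutual information is additive over independent components. -/
lemma mutualInfo_pi (p : ∀ i, Ω₁ i → ℝ) (hp : ∀ i, ∑ ω, p i ω = 1) (f : ∀ i, Ω₁ i → A₁ i)
    (g : ∀ i, Ω₁ i → B₁ i) :
    mutualInfo (fun ω : ∀ i, Ω₁ i => ∏ i, p i (ω i)) (fun (ω : ∀ i, Ω₁ i) i => f i (ω i))
        (fun (ω : ∀ i, Ω₁ i) i => g i (ω i)) =
      ∑ i, mutualInfo (p i) (f i) (g i) := by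
  have h : entropy (fun ω : ∀ i, Ω₁ i => ∏ i, p i (ω i))
        (fun ω : ∀ i, Ω₁ i => (fun i => f i (ω i), fun i => g i (ω i))) =
      entropy (fun ω : ∀ i, Ω₁ i => ∏ i, p i (ω i))
        (fun (ω : ∀ i, Ω₁ i) i => (f i (ω i), g i (ω i))) :=
    entropy_comp_injective _ (fun (ω : ∀ i, Ω₁ i) (i : ι) => (f i (ω i), g i (ω i)))
      (g := fun z => (fun i => (z i).1, fun i => (z i).2)) fun z w hzw => by
        rw [Prod.ext_iff] at hzw
        funext i
        exact Prod.ext (congrFun hzw.1 i) (congrFun hzw.2 i)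
  simp only [mutualInfo]
  rw [h, entropy_pi p hp f, entropy_pi p hp g, entropy_pi p hp fun i ω => (f i ω, g i ω),
    ← Finset.sum_add_distrib, ← Finset.sum_sub_distrib]

end Shannon

/-! ### Greedy rejection sampling -/

section Sampling

variable {B : Type*} [Fintype B]

/-- Greedy rejection sampling of the target `R` from i.i.d. proposals of law `Q`: after `k`
proposals, the mass of the target that has been produced at `b` is
`min (R b) (satLevel Q R k * Q b)`, and the level grows at each step by the probability that no
proposal has been accepted so far. -/
noncomputable def satLevel (Q R : B → ℝ) : ℕ → ℝ
  | 0 => 0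
  | k + 1 => satLevel Q R k + (1 - ∑ b, min (R b) (satLevel Q R k * Q b))

/-- The part of the target mass at `b` that is produced by the first `k` proposals. -/
noncomputable def covered (Q R : B → ℝ) (k : ℕ) (b : B) : ℝ := min (R b) (satLevel Q R k * Q b)

/-- The probability that the first `k` proposals are all rejected. -/
noncomputable def remaining (Q R : B → ℝ) (k : ℕ) : ℝ := 1 - ∑ b, covered Q R k b

/-- The probability that the proposal with index `k` (counted from `0`) is the first accepted one
and has the value `b`. -/
noncomputable def accepted (Q R : B → ℝ) (k : ℕ) (b : B) : ℝ :=
  covered Q R (k + 1) b - covered Q R k b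

/-- The probability that the proposal with index `k` has the value `b` and is accepted, given that
all the earlier ones were rejected. It is `0` when these are rejected with probability `0`. -/
noncomputable def acceptRate (Q R : B → ℝ) (k : ℕ) (b : B) : ℝ :=
  accepted Q R k b / remaining Q R k

variable {Q R : B → ℝ}

lemma satLevel_succ (k : ℕ) : satLevel Q R (k + 1) = satLevel Q R k + remaining Q R k := rfl

lemma covered_le (k : ℕ) (b : B) : covered Q R k b ≤ R b := min_le_left _ _

lemma covered_zero (hR : R ∈ stdSimplex ℝ B) (b : B) : covered Q R 0 b = 0 := by
  simp [covered, satLevel, hR.1 b]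

lemma remaining_zero (hR : R ∈ stdSimplex ℝ B) : remaining Q R 0 = 1 := by
  simp [remaining, covered_zero hR]

lemma remaining_nonneg (hR : R ∈ stdSimplex ℝ B) (k : ℕ) : 0 ≤ remaining Q R k := by
  have := Finset.sum_le_sum fun b (_ : b ∈ Finset.univ) => covered_le (Q := Q) (R := R) k b
  rw [hR.2] at this
  simpa [remaining] using this

lemma remaining_sub_succ (k : ℕ) :
    remaining Q R k - remaining Q R (k + 1) = ∑ b, accepted Q R k b := by
  simp only [remaining, accepted, Finset.sum_sub_distrib]; ring

lemma accepted_nonneg (hQ : Q ∈ stdSimplex ℝ B) (hR : R ∈ stdSimplex ℝ B) (k : ℕ) (b : B) :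
    0 ≤ accepted Q R k b := by
  have := mul_nonneg (remaining_nonneg (Q := Q) hR k) (hQ.1 b)
  rw [accepted, sub_nonneg, covered, covered, satLevel_succ]
  exact min_le_min_left _ (by linarith)

lemma accepted_le (hQ : Q ∈ stdSimplex ℝ B) (hR : R ∈ stdSimplex ℝ B) (k : ℕ) (b : B) :
    accepted Q R k b ≤ remaining Q R k * Q b := by
  have := mul_nonneg (remaining_nonneg (Q := Q) hR k) (hQ.1 b)
  rw [accepted, sub_le_iff_le_add', covered, covered, satLevel_succ, ← min_add_add_right]
  exact min_le_min (by linarith) (by linarith)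

lemma remaining_antitone (hQ : Q ∈ stdSimplex ℝ B) (hR : R ∈ stdSimplex ℝ B) :
    Antitone (remaining Q R) := antitone_nat_of_succ_le fun k => by
  have := Finset.sum_nonneg fun b (_ : b ∈ Finset.univ) => accepted_nonneg hQ hR k b
  rw [← remaining_sub_succ] at this
  linarith

/-- The level is the sum of the rejection probabilities so far, which are decreasing. -/
lemma mul_remaining_le_satLevel (hQ : Q ∈ stdSimplex ℝ B) (hR : R ∈ stdSimplex ℝ B) (k : ℕ) :
    k * remaining Q R k ≤ satLevel Q R k := by
  induction k with
  | zero => simp [satLevel]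
  | succ k ih =>
    have h := remaining_antitone hQ hR k.le_succ
    have h2 := mul_le_mul_of_nonneg_left h (Nat.cast_nonneg (α := ℝ) k)
    rw [satLevel_succ]
    push_cast
    simp only [Nat.succ_eq_add_one] at h h2
    linarith

lemma remaining_mul_acceptRate (hQ : Q ∈ stdSimplex ℝ B) (hR : R ∈ stdSimplex ℝ B) (k : ℕ)
    (b : B) : remaining Q R k * acceptRate Q R k b = accepted Q R k b := by
  rcases eq_or_ne (remaining Q R k) 0 with h | h
  · have := accepted_le hQ hR k b
    rw [h, zero_mul] at this ⊢
    exact le_antisymm (accepted_nonneg hQ hR k b) this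
  · exact mul_div_cancel₀ _ h

lemma acceptRate_nonneg (hQ : Q ∈ stdSimplex ℝ B) (hR : R ∈ stdSimplex ℝ B) (k : ℕ) (b : B) :
    0 ≤ acceptRate Q R k b := div_nonneg (accepted_nonneg hQ hR k b) (remaining_nonneg hR k)

lemma acceptRate_le (hQ : Q ∈ stdSimplex ℝ B) (hR : R ∈ stdSimplex ℝ B) (k : ℕ) (b : B) :
    acceptRate Q R k b ≤ Q b :=
  div_le_of_le_mul₀ (remaining_nonneg hR k) (hQ.1 b) (by
    rw [mul_comm]; exact accepted_le hQ hR k b)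

/-- The factor with index `j` is the probability to reject the proposal `j` if it is reached. -/
lemma prod_one_sub_sum_acceptRate (hQ : Q ∈ stdSimplex ℝ B) (hR : R ∈ stdSimplex ℝ B) (k : ℕ) :
    ∏ j ∈ Finset.range k, ∑ b, (Q b - acceptRate Q R j b) = remaining Q R k := by
  induction k with
  | zero => simp [remaining_zero hR]
  | succ k ih =>
    rw [Finset.prod_range_succ, ih, Finset.sum_sub_distrib, hQ.2, mul_sub, mul_one, Finset.mul_sum,
      Finset.sum_congr rfl fun b _ => remaining_mul_acceptRate hQ hR k b, ← remaining_sub_succ]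
    ring

/-- The joint probability of the proposals `u` and of the event that the proposal `k` is the first
accepted one. -/
noncomputable def hit (Q R : B → ℝ) {T : ℕ} (u : Fin T → B) (k : Fin T) : ℝ :=
  acceptRate Q R k (u k) * (∏ j with j < k, (Q (u j) - acceptRate Q R j (u j))) *
    ∏ j with k < j, Q (u j)

/-- The joint probability of the proposals `u` and of the event that all are rejected. -/
noncomputable def miss (Q R : B → ℝ) {T : ℕ} (u : Fin T → B) : ℝ :=
  ∏ j, (Q (u j) - acceptRate Q R j (u j))

lemma hit_nonneg (hQ : Q ∈ stdSimplex ℝ B) (hR : R ∈ stdSimplex ℝ B) {T : ℕ} (u : Fin T → B)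
    (k : Fin T) : 0 ≤ hit Q R u k :=
  mul_nonneg (mul_nonneg (acceptRate_nonneg hQ hR _ _)
    (Finset.prod_nonneg fun _ _ => sub_nonneg.2 (acceptRate_le hQ hR _ _)))
    (Finset.prod_nonneg fun _ _ => hQ.1 _)

lemma miss_nonneg (hQ : Q ∈ stdSimplex ℝ B) (hR : R ∈ stdSimplex ℝ B) {T : ℕ} (u : Fin T → B) :
    0 ≤ miss Q R u :=
  Finset.prod_nonneg fun _ _ => sub_nonneg.2 (acceptRate_le hQ hR _ _)

/-- The proposals are i.i.d. of law `Q`, whatever the target. -/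
lemma miss_add_sum_hit {T : ℕ} (u : Fin T → B) :
    miss Q R u + ∑ k, hit Q R u k = ∏ j, Q (u j) := by
  rw [miss, Finset.prod_sub_ordered]
  simp only [hit, sub_add_cancel]

lemma sum_miss (hQ : Q ∈ stdSimplex ℝ B) (hR : R ∈ stdSimplex ℝ B) (T : ℕ) :
    ∑ u : Fin T → B, miss Q R u = remaining Q R T := by
  simp only [miss]
  rw [sum_pi_prod fun (j : Fin T) b => Q b - acceptRate Q R j b,
    ← prod_one_sub_sum_acceptRate hQ hR,
    Finset.prod_range fun j => ∑ b, (Q b - acceptRate Q R j b)]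

/-- The proposal `k` is the first accepted one and equals `b` with probability `accepted Q R k b`:
the sum over `u` factors over the proposals before, at and after `k`. -/
lemma sum_hit_eq [DecidableEq B] (hQ : Q ∈ stdSimplex ℝ B) (hR : R ∈ stdSimplex ℝ B) {T : ℕ}
    (k : Fin T) (b : B) :
    ∑ u : Fin T → B, (if u k = b then hit Q R u k else 0) = accepted Q R k b := by
  set f : Fin T → B → ℝ := fun j c => if j < k then Q c - acceptRate Q R j c else
    if k < j then Q c else if c = b then acceptRate Q R k c else 0 with hf
  have h1 : ∀ g : Fin T → ℝ, ∏ j, g j = g k * (∏ j with j < k, g j) * ∏ j with k < j, g j := by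
    intro g
    rw [← Finset.prod_filter_mul_prod_filter_not Finset.univ (· < k), mul_comm (g k), mul_assoc]
    congr 1
    have : (Finset.univ.filter fun j => ¬ j < k) = insert k (Finset.univ.filter (k < ·)) := by
      ext j; simp only [Finset.mem_filter, Finset.mem_univ, true_and, Finset.mem_insert, not_lt,
        le_iff_eq_or_lt, eq_comm]
    rw [this, Finset.prod_insert (by simp)]
  have h2 : ∀ u : Fin T → B, (if u k = b then hit Q R u k else 0) = ∏ j, f j (u j) := by
    intro u
    rw [h1 fun j => f j (u j), hit]
    have e1 : ∏ j with j < k, f j (u j) = ∏ j with j < k, (Q (u j) - acceptRate Q R j (u j)) :=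
      Finset.prod_congr rfl fun j hj => by simp [hf, (Finset.mem_filter.1 hj).2]
    have e2 : ∏ j with k < j, f j (u j) = ∏ j with k < j, Q (u j) :=
      Finset.prod_congr rfl fun j hj => by
        simp [hf, (Finset.mem_filter.1 hj).2, (Finset.mem_filter.1 hj).2.le]
    rw [e1, e2]
    by_cases h : u k = b <;> simp [hf, h]
  rw [Finset.sum_congr rfl fun u _ => h2 u, sum_pi_prod, h1 fun j => ∑ c, f j c]
  have e1 : ∏ j with j < k, ∑ c, f j c = remaining Q R k := by
    rw [← prod_one_sub_sum_acceptRate hQ hR]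
    refine Finset.prod_bij' (fun j _ => (j : ℕ)) (fun j hj => ⟨j, ?_⟩) ?_ ?_ ?_ ?_ ?_
    · exact (Finset.mem_range.1 hj).trans k.2
    · intro j hj; simpa using hj
    · intro j hj; exact Finset.mem_filter.2 ⟨Finset.mem_univ _, Finset.mem_range.1 hj⟩
    · intro j hj; rfl
    · intro j hj; rfl
    · intro j hj; simp [hf, (Finset.mem_filter.1 hj).2]
  have e2 : ∏ j with k < j, ∑ c, f j c = 1 :=
    Finset.prod_eq_one fun j hj => by
      simp [hf, (Finset.mem_filter.1 hj).2, (Finset.mem_filter.1 hj).2.le, hQ.2]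
  have e3 : ∑ c, f k c = acceptRate Q R k b := by simp [hf]
  rw [e1, e2, e3, mul_one, mul_comm, remaining_mul_acceptRate hQ hR]

lemma sum_hit (hQ : Q ∈ stdSimplex ℝ B) (hR : R ∈ stdSimplex ℝ B) {T : ℕ} (k : Fin T) :
    ∑ u : Fin T → B, hit Q R u k = ∑ b, accepted Q R k b := by
  classical
  rw [← Finset.sum_congr rfl fun b _ => sum_hit_eq hQ hR k b, Finset.sum_comm]
  simp

/-! ### The number of proposals -/

/-- Greediness: target mass at `b` that is left after `k` proposals forces the level, hence
`k * remaining Q R k`, to be below the density `R b / Q b`. -/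
lemma succ_mul_remaining_le (hQ : Q ∈ stdSimplex ℝ B) (hR : R ∈ stdSimplex ℝ B)
    (hac : ∀ b, Q b = 0 → R b = 0) {k : ℕ} {b : B} (h : covered Q R k b < R b) :
    0 < Q b ∧ (k + 1) * remaining Q R k ≤ 1 + R b / Q b := by
  have h1 : satLevel Q R k * Q b < R b := by
    by_contra! h1
    exact h.ne (min_eq_left h1)
  have hQb : 0 < Q b := by
    refine (hQ.1 b).lt_of_ne fun h0 => ?_
    have := hac b h0.symm
    simp [← h0, this] at h1
  have h2 := mul_remaining_le_satLevel hQ hR k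
  have h3 : satLevel Q R k ≤ R b / Q b := by rw [le_div_iff₀ hQb]; exact h1.le
  have h4 := remaining_antitone hQ hR (Nat.zero_le k)
  rw [remaining_zero hR] at h4
  exact ⟨hQb, by linarith⟩

lemma log_succ_le (hQ : Q ∈ stdSimplex ℝ B) (hR : R ∈ stdSimplex ℝ B)
    (hac : ∀ b, Q b = 0 → R b = 0) {k : ℕ} {b : B} (h : covered Q R k b < R b)
    (hk : 0 < remaining Q R k) :
    Real.log (k + 1) ≤ Real.log (1 + R b / Q b) - Real.log (remaining Q R k) := by
  have h1 := (succ_mul_remaining_le hQ hR hac h).2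
  have h2 : (0 : ℝ) < k + 1 := by positivity
  rw [le_sub_iff_add_le, ← Real.log_mul h2.ne' hk.ne']
  exact Real.log_le_log (by positivity) h1

lemma accepted_mul_log_le (hQ : Q ∈ stdSimplex ℝ B) (hR : R ∈ stdSimplex ℝ B)
    (hac : ∀ b, Q b = 0 → R b = 0) (k : ℕ) (b : B) :
    accepted Q R k b * Real.log (k + 1) ≤
      accepted Q R k b * (Real.log (1 + R b / Q b) - Real.log (remaining Q R k)) := by
  rcases (accepted_nonneg hQ hR k b).eq_or_lt with h | h
  · simp [← h]
  · have h1 : covered Q R k b < R b :=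
      (sub_pos.1 h).trans_le (covered_le (k + 1) b)
    have h2 : 0 < remaining Q R k := by
      have := h.trans_le (accepted_le hQ hR k b)
      exact pos_of_mul_pos_left this (hQ.1 b)
    exact mul_le_mul_of_nonneg_left (log_succ_le hQ hR hac h1 h2) h.le

lemma remaining_eq_sum (hR : R ∈ stdSimplex ℝ B) (k : ℕ) :
    remaining Q R k = ∑ b, (R b - covered Q R k b) := by
  rw [Finset.sum_sub_distrib, hR.2, remaining]

lemma residual_mul_log_le (hQ : Q ∈ stdSimplex ℝ B) (hR : R ∈ stdSimplex ℝ B)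
    (hac : ∀ b, Q b = 0 → R b = 0) (k : ℕ) (b : B) :
    (R b - covered Q R k b) * Real.log (k + 1) ≤
      (R b - covered Q R k b) * (Real.log (1 + R b / Q b) - Real.log (remaining Q R k)) := by
  have hn : ∀ b, 0 ≤ R b - covered Q R k b := fun b => sub_nonneg.2 (covered_le k b)
  rcases (hn b).eq_or_lt with h | h
  · simp [← h]
  · have h2 : 0 < remaining Q R k := by
      rw [remaining_eq_sum hR]
      exact h.trans_le (Finset.single_le_sum (fun b _ => hn b) (Finset.mem_univ b))
    exact mul_le_mul_of_nonneg_left (log_succ_le hQ hR hac (sub_pos.1 h) h2) h.le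

/-- A Riemann sum of `∫₀¹ -log t dt = 1`. -/
lemma sub_mul_neg_log_le {a b : ℝ} (hb : 0 ≤ b) (hab : b ≤ a) :
    (a - b) * -Real.log a ≤ (a - a * Real.log a) - (b - b * Real.log b) := by
  rcases hb.eq_or_lt with h | h
  · subst h; simp; linarith [hab]
  · have ha : 0 < a := h.trans_le hab
    have h1 : Real.log (a / b) ≤ a / b - 1 := Real.log_le_sub_one_of_pos (by positivity)
    rw [Real.log_div ha.ne' h.ne'] at h1
    have h2 := mul_le_mul_of_nonneg_left h1 h.le
    rw [mul_sub, mul_sub, mul_div_cancel₀ _ h.ne'] at h2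
    linarith

lemma sum_remaining_log_le (hQ : Q ∈ stdSimplex ℝ B) (hR : R ∈ stdSimplex ℝ B) (T : ℕ) :
    ∑ k ∈ Finset.range T, (∑ b, accepted Q R k b) * -Real.log (remaining Q R k) +
      remaining Q R T * -Real.log (remaining Q R T) ≤ 1 := by
  have h : ∑ k ∈ Finset.range T, (∑ b, accepted Q R k b) * -Real.log (remaining Q R k) ≤
      1 - (remaining Q R T - remaining Q R T * Real.log (remaining Q R T)) := by
    have h0 : (1 : ℝ) = remaining Q R 0 - remaining Q R 0 * Real.log (remaining Q R 0) := by
      simp [remaining_zero hR]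
    rw [h0, ← Finset.sum_range_sub' fun k =>
      remaining Q R k - remaining Q R k * Real.log (remaining Q R k)]
    refine Finset.sum_le_sum fun k _ => ?_
    rw [← remaining_sub_succ]
    exact sub_mul_neg_log_le (remaining_nonneg hR _) (remaining_antitone hQ hR k.le_succ)
  have := remaining_nonneg (Q := Q) hR T
  linarith

/-- The summation of `log ((1 + Q b / R b) / 2) ≤ (Q b / R b - 1) / 2` against `R`. -/
lemma mul_log_one_add_div_le (hQ : Q ∈ stdSimplex ℝ B) (hR : R ∈ stdSimplex ℝ B)
    (hac : ∀ b, Q b = 0 → R b = 0) :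
    ∑ b, R b * Real.log (1 + R b / Q b) ≤ ∑ b, R b * Real.log (R b / Q b) + Real.log 2 := by
  have key : ∀ b, R b * Real.log (1 + R b / Q b) ≤
      R b * Real.log (R b / Q b) + R b * Real.log 2 + (Q b - R b) / 2 := by
    intro b
    rcases (hR.1 b).eq_or_lt with h | h
    · have := hQ.1 b
      simp only [← h, zero_mul, zero_add, sub_zero]
      linarith
    · have hq : 0 < Q b := (hQ.1 b).lt_of_ne fun h0 => h.ne' (hac b h0.symm)
      have hr : 0 < R b / Q b := by positivity
      have h1 : Real.log ((1 + R b / Q b) / (R b / Q b * 2)) ≤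
          (1 + R b / Q b) / (R b / Q b * 2) - 1 := Real.log_le_sub_one_of_pos (by positivity)
      rw [Real.log_div (by positivity) (by positivity), Real.log_mul hr.ne' two_ne_zero] at h1
      have h2 := mul_le_mul_of_nonneg_left h1 h.le
      have h3 : R b * ((1 + R b / Q b) / (R b / Q b * 2) - 1) = (Q b - R b) / 2 := by
        field_simp; ring
      rw [h3] at h2
      linarith
  refine (Finset.sum_le_sum fun b _ => key b).trans_eq ?_
  rw [Finset.sum_add_distrib, Finset.sum_add_distrib, ← Finset.sum_mul, ← Finset.sum_div,
    Finset.sum_sub_distrib, hQ.2, hR.2]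
  ring

/-- The expected logarithm of the number of proposals exceeds the divergence of the target from
the law of the proposals by at most `1 + log 2`. Rejection of all the `T` proposals is counted as
`T + 1` proposals. -/
lemma expected_log_le (hQ : Q ∈ stdSimplex ℝ B) (hR : R ∈ stdSimplex ℝ B)
    (hac : ∀ b, Q b = 0 → R b = 0) (T : ℕ) :
    ∑ k ∈ Finset.range T, (∑ b, accepted Q R k b) * Real.log (k + 1) +
      remaining Q R T * Real.log (T + 1) ≤
        ∑ b, R b * Real.log (R b / Q b) + (1 + Real.log 2) := by
  have h1 : ∑ k ∈ Finset.range T, (∑ b, accepted Q R k b) * Real.log (k + 1) ≤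
      ∑ k ∈ Finset.range T, ∑ b, accepted Q R k b * Real.log (1 + R b / Q b) +
      ∑ k ∈ Finset.range T, (∑ b, accepted Q R k b) * -Real.log (remaining Q R k) := by
    rw [← Finset.sum_add_distrib]
    refine Finset.sum_le_sum fun k _ => ?_
    rw [Finset.sum_mul, Finset.sum_mul, ← Finset.sum_add_distrib]
    refine Finset.sum_le_sum fun b _ => ?_
    rw [← mul_add]
    exact accepted_mul_log_le hQ hR hac k b
  have h2 : remaining Q R T * Real.log (T + 1) ≤
      ∑ b, (R b - covered Q R T b) * Real.log (1 + R b / Q b) +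
      remaining Q R T * -Real.log (remaining Q R T) := by
    nth_rewrite 1 2 [remaining_eq_sum hR]
    rw [Finset.sum_mul, Finset.sum_mul, ← Finset.sum_add_distrib]
    refine Finset.sum_le_sum fun b _ => ?_
    rw [← mul_add]
    exact residual_mul_log_le hQ hR hac T b
  have h3 : ∑ k ∈ Finset.range T, ∑ b, accepted Q R k b * Real.log (1 + R b / Q b) +
      ∑ b, (R b - covered Q R T b) * Real.log (1 + R b / Q b) =
      ∑ b, R b * Real.log (1 + R b / Q b) := by
    rw [Finset.sum_comm, ← Finset.sum_add_distrib]
    refine Finset.sum_congr rfl fun b _ => ?_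
    rw [← Finset.sum_mul, ← add_mul]
    congr 1
    simp only [accepted]
    rw [Finset.sum_range_sub fun k => covered Q R k b, covered_zero hR]
    ring
  have h4 := sum_remaining_log_le hQ hR T
  have h5 := mul_log_one_add_div_le hQ hR hac
  linarith

/-- The probability that `T` proposals are all rejected tends to `0` as `T` grows. -/
lemma mul_remaining_le (hQ : Q ∈ stdSimplex ℝ B) (hR : R ∈ stdSimplex ℝ B) {M : ℝ} (hM : 0 ≤ M)
    (hRM : ∀ b, R b ≤ M * Q b) (T : ℕ) : T * remaining Q R T ≤ M := by
  rcases (remaining_nonneg (Q := Q) hR T).eq_or_lt with h | h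
  · simpa [← h] using hM
  · refine (mul_remaining_le_satLevel hQ hR T).trans ?_
    by_contra! hc
    refine h.ne' ?_
    rw [remaining_eq_sum hR]
    refine Finset.sum_eq_zero fun b _ => sub_eq_zero.2 (min_eq_left ?_).symm
    exact (hRM b).trans (mul_le_mul_of_nonneg_right hc.le (hQ.1 b))

end Sampling

/-! ### A code for the integers -/

/-- The weight of the integer `k` in a code with polynomially decaying weights. -/
noncomputable def codeWeight (θ : ℝ) (k : ℕ) : ℝ := ((k : ℝ) + 1) ^ (-(1 + θ)) / (1 + 1 / θ)

lemma codeWeight_pos {θ : ℝ} (hθ : 0 < θ) (k : ℕ) : 0 < codeWeight θ k := by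
  unfold codeWeight; positivity

lemma neg_log_codeWeight {θ : ℝ} (hθ : 0 < θ) (k : ℕ) :
    -Real.log (codeWeight θ k) = (1 + θ) * Real.log (k + 1) + Real.log (1 + 1 / θ) := by
  rw [codeWeight, Real.log_div (by positivity) (by positivity), Real.log_rpow (by positivity)]
  ring

/-- Comparison of `(x + 1) ^ (-(1 + θ))` with a telescoping difference. -/
lemma rpow_neg_one_add_le {θ : ℝ} (hθ : 0 < θ) {x : ℝ} (hx : 0 < x) :
    θ * (x + 1) ^ (-(1 + θ)) ≤ x ^ (-θ) - (x + 1) ^ (-θ) := by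
  have hx1 : 0 < x + 1 := by positivity
  have h1 : 1 - ((x + 1) / x)⁻¹ ≤ Real.log ((x + 1) / x) :=
    Real.one_sub_inv_le_log_of_pos (by positivity)
  have h2 : (x + 1) ^ (-(1 + θ)) = (x + 1) ^ (-θ) * (x + 1)⁻¹ := by
    rw [neg_add_rev, Real.rpow_add hx1, Real.rpow_neg_one]
  have h3 : x ^ (-θ) = (x + 1) ^ (-θ) * Real.exp (θ * Real.log ((x + 1) / x)) := by
    rw [Real.rpow_def_of_pos hx, Real.rpow_def_of_pos hx1, ← Real.exp_add,
      Real.log_div hx1.ne' hx.ne']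
    ring_nf
  have h4 := Real.add_one_le_exp (θ * Real.log ((x + 1) / x))
  have h5 : 1 - ((x + 1) / x)⁻¹ = (x + 1)⁻¹ := by field_simp; ring
  rw [h5] at h1
  have h6 := mul_le_mul_of_nonneg_left h1 hθ.le
  rw [h2, h3]
  have h7 : 0 < (x + 1) ^ (-θ) := Real.rpow_pos_of_pos hx1 _
  have h8 := mul_le_mul_of_nonneg_left (show θ * (x + 1)⁻¹ ≤
    Real.exp (θ * Real.log ((x + 1) / x)) - 1 by linarith) h7.le
  linarith

lemma sum_codeWeight_le {θ : ℝ} (hθ : 0 < θ) (n : ℕ) :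
    ∑ k ∈ Finset.range n, codeWeight θ k ≤ 1 := by
  have h : ∀ n : ℕ, ∑ k ∈ Finset.range (n + 1), ((k : ℝ) + 1) ^ (-(1 + θ)) ≤
      1 + (1 - ((n : ℝ) + 1) ^ (-θ)) / θ := by
    intro n
    induction n with
    | zero => simp
    | succ n ih =>
      rw [Finset.sum_range_succ]
      have := rpow_neg_one_add_le hθ (x := (n : ℝ) + 1) (by positivity)
      rw [mul_comm, ← le_div_iff₀ hθ] at this
      push_cast
      rw [sub_div] at this ih ⊢
      linarith
  have h2 : ∑ k ∈ Finset.range n, ((k : ℝ) + 1) ^ (-(1 + θ)) ≤ 1 + 1 / θ := by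
    refine (Finset.sum_le_sum_of_subset_of_nonneg (Finset.range_mono n.le_succ)
      fun _ _ _ => by positivity).trans ((h n).trans ?_)
    gcongr
    have : 0 < ((n : ℝ) + 1) ^ (-θ) := by positivity
    linarith
  simp only [codeWeight]
  rw [← Finset.sum_div, div_le_one (by positivity)]
  exact h2

/-! ### Sampling from a target with a short description of the sample -/

section Sampler

/-- Conditional probabilities: a nonnegative function is its total mass times a probability mass
function. The law `q` serves where the total mass is zero. -/
lemma exists_conditional {C : Type*} [Fintype C] {g q : C → ℝ} (hg : ∀ c, 0 ≤ g c)
    (hq : q ∈ stdSimplex ℝ C) :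
    ∃ ρ ∈ stdSimplex ℝ C, (∀ c, g c = (∑ c, g c) * ρ c) ∧ ∀ c, q c = 0 → g c = 0 → ρ c = 0 := by
  rcases (Finset.sum_nonneg fun c (_ : c ∈ Finset.univ) => hg c).eq_or_lt with h | h
  · refine ⟨q, hq, fun c => ?_, fun c h _ => h⟩
    rw [← h, zero_mul]
    exact (Finset.sum_eq_zero_iff_of_nonneg fun c _ => hg c).1 h.symm c (Finset.mem_univ c)
  · refine ⟨fun c => g c / ∑ c, g c, ⟨fun c => div_nonneg (hg c) h.le, ?_⟩, fun c => ?_,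
      fun c _ h => by simp [h]⟩
    · rw [← Finset.sum_div, div_self h.ne']
    · rw [mul_div_cancel₀ _ h.ne']

variable {B : Type*} [Fintype B]

open Classical in
/-- A code for a sample `b` given the proposals `u`: name the index of a proposal equal to `b`, or
say that all proposals are rejected and name `b` itself. -/
noncomputable def code (θ : ℝ) {T : ℕ} (b : B) (u : Fin T → B) : ℝ :=
  ∑ k : Fin T, (if u k = b then codeWeight θ k else 0) + codeWeight θ T / Fintype.card B

lemma code_pos {θ : ℝ} (hθ : 0 < θ) {T : ℕ} (b : B) (u : Fin T → B) : 0 < code θ b u := by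
  have : 0 < Fintype.card B := Fintype.card_pos_iff.2 ⟨b⟩
  have h := codeWeight_pos hθ T
  refine add_pos_of_nonneg_of_pos (Finset.sum_nonneg fun k _ => ?_) (by positivity)
  split_ifs
  exacts [(codeWeight_pos hθ k).le, le_rfl]

lemma sum_code_le {θ : ℝ} (hθ : 0 < θ) {T : ℕ} (u : Fin T → B) : ∑ b, code θ b u ≤ 1 := by
  classical
  refine le_trans ?_ (sum_codeWeight_le hθ (T + 1))
  rw [Finset.sum_range_succ, Finset.sum_range]
  simp only [code, Finset.sum_add_distrib]
  rw [Finset.sum_comm]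
  have h := codeWeight_pos hθ T
  refine add_le_add (by simp) ?_
  rw [Finset.sum_const, nsmul_eq_mul, Finset.card_univ]
  rcases eq_or_ne (Fintype.card B : ℝ) 0 with h0 | h0
  · simpa [h0] using h.le
  · rw [mul_div_cancel₀ _ h0]

lemma codeWeight_le_code {θ : ℝ} (hθ : 0 < θ) {T : ℕ} (u : Fin T → B) (k : Fin T) :
    codeWeight θ k ≤ code θ (u k) u := by
  classical
  have h := codeWeight_pos hθ T
  have h1 := Finset.single_le_sum
    (f := fun j : Fin T => if u j = u k then codeWeight θ j else 0)
    (fun j _ => by split_ifs <;> simp [(codeWeight_pos hθ j).le]) (Finset.mem_univ k)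
  simp only [if_true] at h1
  exact h1.trans (le_add_of_nonneg_right (by positivity))

lemma codeWeight_div_le_code {θ : ℝ} (hθ : 0 < θ) {T : ℕ} (b : B) (u : Fin T → B) :
    codeWeight θ T / Fintype.card B ≤ code θ b u :=
  le_add_of_nonneg_left (Finset.sum_nonneg fun k _ => by
    split_ifs <;> simp [(codeWeight_pos hθ _).le])

/-- Any target `R` can be coupled to `T` i.i.d. proposals of law `Q` such that, given the proposals,
the sample has an expected code length of little more than the divergence of `R` from `Q`. -/
lemma exists_sampler {Q R : B → ℝ} (hQ : Q ∈ stdSimplex ℝ B) (hR : R ∈ stdSimplex ℝ B)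
    (hac : ∀ b, Q b = 0 → R b = 0) (T : ℕ) :
    ∃ J : (Fin T → B) → B → ℝ, (∀ u b, 0 ≤ J u b) ∧ (∀ u, ∑ b, J u b = ∏ j, Q (u j)) ∧
      (∀ b, ∑ u, J u b = R b) ∧ ∀ θ, 0 < θ →
        ∑ u, ∑ b, J u b * -Real.log (code θ b u) ≤
          (1 + θ) * (∑ b, R b * Real.log (R b / Q b) + (1 + Real.log 2)) +
            Real.log (1 + 1 / θ) + remaining Q R T * Real.log (Fintype.card B) := by
  classical
  -- `ρ` is the law of the sample when all proposals are rejected.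
  obtain ⟨ρ, hρ, hρR, -⟩ := exists_conditional
    (fun b => sub_nonneg.2 (covered_le (Q := Q) (R := R) T b)) hR
  simp only [← remaining_eq_sum hR] at hρR
  refine ⟨fun u b => ∑ k, (if u k = b then hit Q R u k else 0) + miss Q R u * ρ b,
    fun u b => ?_, fun u => ?_, fun b => ?_, fun θ hθ => ?_⟩
  · refine add_nonneg (Finset.sum_nonneg fun k _ => ?_) (mul_nonneg (miss_nonneg hQ hR u) (hρ.1 b))
    split_ifs
    exacts [hit_nonneg hQ hR u k, le_rfl]
  · rw [Finset.sum_add_distrib, Finset.sum_comm, ← Finset.mul_sum, hρ.2,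
      ← miss_add_sum_hit (R := R)]
    simp [add_comm]
  · rw [Finset.sum_add_distrib, Finset.sum_comm, ← Finset.sum_mul, sum_miss hQ hR, ← hρR,
      Finset.sum_congr rfl fun k _ => sum_hit_eq hQ hR k b,
      ← Finset.sum_range fun k => accepted Q R k b]
    simp only [accepted]
    rw [Finset.sum_range_sub fun k => covered Q R k b, covered_zero hR]
    ring
  · set L := Real.log (1 + 1 / θ) with hL
    set c := Real.log (Fintype.card B) with hc
    have hlog : ∀ {x y : ℝ}, 0 < x → x ≤ y → -Real.log y ≤ -Real.log x := fun hx hxy =>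
      neg_le_neg (Real.log_le_log hx hxy)
    have h1 : ∀ u : Fin T → B, ∑ b, (∑ k, (if u k = b then hit Q R u k else 0) +
        miss Q R u * ρ b) * -Real.log (code θ b u) ≤
        ∑ k : Fin T, hit Q R u k * ((1 + θ) * Real.log ((k : ℕ) + 1) + L) +
          miss Q R u * ((1 + θ) * Real.log (T + 1) + L + c) := by
      intro u
      simp only [add_mul, Finset.sum_add_distrib, Finset.sum_mul]
      refine add_le_add ?_ ?_
      · rw [Finset.sum_comm]
        refine Finset.sum_le_sum fun k _ => ?_
        simp only [ite_mul, zero_mul, Finset.sum_ite_eq, Finset.mem_univ, if_true]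
        refine mul_le_mul_of_nonneg_left ?_ (hit_nonneg hQ hR u k)
        rw [← add_mul, ← neg_log_codeWeight hθ]
        exact hlog (codeWeight_pos hθ k) (codeWeight_le_code hθ u k)
      · have h2 : ∀ b, miss Q R u * ρ b * -Real.log (code θ b u) ≤
            miss Q R u * ρ b * ((1 + θ) * Real.log (T + 1) + L + c) := by
          intro b
          refine mul_le_mul_of_nonneg_left ?_ (mul_nonneg (miss_nonneg hQ hR u) (hρ.1 b))
          have hB : (0 : ℝ) < Fintype.card B := by
            exact_mod_cast Fintype.card_pos_iff.2 ⟨b⟩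
          have h3 := codeWeight_pos hθ T
          refine (hlog (by positivity) (codeWeight_div_le_code hθ b u)).trans_eq ?_
          rw [Real.log_div h3.ne' hB.ne', ← neg_log_codeWeight hθ]
          ring
        refine (Finset.sum_le_sum fun b _ => h2 b).trans_eq ?_
        rw [← Finset.sum_mul, ← Finset.mul_sum, hρ.2]
        ring
    refine (Finset.sum_le_sum fun u _ => h1 u).trans ?_
    rw [Finset.sum_add_distrib, Finset.sum_comm, ← Finset.sum_mul, sum_miss hQ hR]
    simp only [← Finset.sum_mul, sum_hit hQ hR]
    rw [← Finset.sum_range fun k : ℕ =>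
      (∑ b, accepted Q R k b) * ((1 + θ) * Real.log ((k : ℕ) + 1) + L)]
    have h4 := mul_le_mul_of_nonneg_left (expected_log_le hQ hR hac T) (by linarith : 0 ≤ 1 + θ)
    have h5 : ∑ k ∈ Finset.range T, ∑ b, accepted Q R k b = 1 - remaining Q R T := by
      rw [← remaining_zero (Q := Q) hR, ← Finset.sum_range_sub' (remaining Q R)]
      exact Finset.sum_congr rfl fun k _ => (remaining_sub_succ k).symm
    have h6 : ∑ k ∈ Finset.range T,
        (∑ b, accepted Q R k b) * ((1 + θ) * Real.log ((k : ℕ) + 1) + L) =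
        (1 + θ) * ∑ k ∈ Finset.range T, (∑ b, accepted Q R k b) * Real.log (k + 1) +
          (1 - remaining Q R T) * L := by
      rw [← h5, Finset.mul_sum, Finset.sum_mul, ← Finset.sum_add_distrib]
      exact Finset.sum_congr rfl fun k _ => by ring
    rw [h6]
    linarith

end Sampler

/-! ### Channels -/

section Channel

variable {Ω A B C D : Type*} [Fintype Ω] [Fintype A] [Fintype B] [Fintype C] [Fintype D]

/-- The joint law of a sample point `ω` of law `p` and of the output of the channel `W` at `ω`. -/
def channelLaw (p : Ω → ℝ) (W : Ω → C → ℝ) (t : Ω × C) : ℝ := p t.1 * W t.1 t.2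

lemma sum_channelLaw {p : Ω → ℝ} (hp : ∑ ω, p ω = 1) {W : Ω → C → ℝ} (hW : ∀ ω, ∑ c, W ω c = 1) :
    ∑ t, channelLaw p W t = 1 := by
  simp only [channelLaw, Fintype.sum_prod_type, ← Finset.mul_sum, hW, mul_one, hp]

lemma channelLaw_mem_stdSimplex {p : Ω → ℝ} (hp : p ∈ stdSimplex ℝ Ω) {W : Ω → C → ℝ}
    (hW : ∀ ω, W ω ∈ stdSimplex ℝ C) : channelLaw p W ∈ stdSimplex ℝ (Ω × C) :=
  ⟨fun _ => mul_nonneg (hp.1 _) ((hW _).1 _), sum_channelLaw hp.2 fun ω => (hW ω).2⟩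

omit [Fintype A] in
lemma law_channelLaw_input (p : Ω → ℝ) {W : Ω → C → ℝ} (hW : ∀ ω, ∑ c, W ω c = 1) (f : Ω → A) :
    law (channelLaw p W) (fun t => f t.1) = law p f := by
  classical
  funext a
  simp only [law, channelLaw, Fintype.sum_prod_type]
  refine Finset.sum_congr rfl fun ω _ => ?_
  split_ifs <;> simp [← Finset.mul_sum, hW]

lemma entropy_channelLaw_input (p : Ω → ℝ) {W : Ω → C → ℝ} (hW : ∀ ω, ∑ c, W ω c = 1)
    (f : Ω → A) : entropy (channelLaw p W) (fun t => f t.1) = entropy p f := by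
  rw [entropy, law_channelLaw_input p hW, entropy]

lemma law_channelLaw_output (p : Ω → ℝ) (W : Ω → C → ℝ) (c : C) :
    law (channelLaw p W) (fun t => t.2) c = ∑ ω, p ω * W ω c := by
  classical
  simp [law, channelLaw, Fintype.sum_prod_type]

open Classical in
omit [Fintype A] in
lemma law_channelLaw_pair (p : Ω → ℝ) (W : Ω → C → ℝ) (f : Ω → A) (a : A) (c : C) :
    law (channelLaw p W) (fun t => (f t.1, t.2)) (a, c) =
      ∑ ω, if f ω = a then p ω * W ω c else 0 := by
  simp only [law, channelLaw, Fintype.sum_prod_type, Prod.mk.injEq]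
  refine Finset.sum_congr rfl fun ω _ => ?_
  by_cases h : f ω = a <;> simp [h]

lemma sum_negMulLog_const_mul (c : ℝ) (q : A → ℝ) (hq : ∑ a, q a = 1) :
    ∑ a, Real.negMulLog (c * q a) = c * ∑ a, Real.negMulLog (q a) + Real.negMulLog c := by
  simp only [Real.negMulLog_mul, Finset.sum_add_distrib]
  rw [← Finset.sum_mul, ← Finset.mul_sum, hq]
  ring

/-- The channel that announces whether it acts as `W₀` (with probability `1 - α`) or as `W₁`. -/
def mixChannel (α : ℝ) (W₀ : Ω → C → ℝ) (W₁ : Ω → D → ℝ) (ω : Ω) : C ⊕ D → ℝ :=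
  Sum.elim (fun c => (1 - α) * W₀ ω c) fun d => α * W₁ ω d

omit [Fintype Ω] in
lemma mixChannel_mem_stdSimplex {α : ℝ} (h0 : 0 ≤ α) (h1 : α ≤ 1) {W₀ : Ω → C → ℝ}
    {W₁ : Ω → D → ℝ} (hW₀ : ∀ ω, W₀ ω ∈ stdSimplex ℝ C) (hW₁ : ∀ ω, W₁ ω ∈ stdSimplex ℝ D)
    (ω : Ω) : mixChannel α W₀ W₁ ω ∈ stdSimplex ℝ (C ⊕ D) := by
  refine ⟨?_, ?_⟩
  · rintro (c | d)
    · exact mul_nonneg (sub_nonneg.2 h1) ((hW₀ ω).1 c)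
    · exact mul_nonneg h0 ((hW₁ ω).1 d)
  · simp [mixChannel, ← Finset.mul_sum, (hW₀ ω).2, (hW₁ ω).2]

/-- Mutual information is affine under announced mixtures of channels. -/
lemma mutualInfo_mixChannel {p : Ω → ℝ} (hp : ∑ ω, p ω = 1) (α : ℝ) {W₀ : Ω → C → ℝ}
    {W₁ : Ω → D → ℝ} (hW₀ : ∀ ω, ∑ c, W₀ ω c = 1) (hW₁ : ∀ ω, ∑ d, W₁ ω d = 1) (f : Ω → A) :
    mutualInfo (channelLaw p (mixChannel α W₀ W₁)) (fun t => f t.1) (fun t => t.2) =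
      (1 - α) * mutualInfo (channelLaw p W₀) (fun t => f t.1) (fun t => t.2) +
        α * mutualInfo (channelLaw p W₁) (fun t => f t.1) (fun t => t.2) := by
  classical
  -- The entropy of the announcement enters `H(U)` and `H(f, U)` alike, and cancels.
  have hW : ∀ ω, ∑ c, mixChannel α W₀ W₁ ω c = 1 := fun ω => by
    simp [mixChannel, ← Finset.mul_sum, hW₀ ω, hW₁ ω]
  have h1 : entropy (channelLaw p (mixChannel α W₀ W₁)) (fun t => t.2) =
      ((1 - α) * entropy (channelLaw p W₀) (fun t => t.2) + Real.negMulLog (1 - α)) +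
      (α * entropy (channelLaw p W₁) (fun t => t.2) + Real.negMulLog α) := by
    unfold entropy
    rw [Fintype.sum_sum_type,
      ← sum_negMulLog_const_mul (1 - α) _ ((sum_law _ _).trans (sum_channelLaw hp hW₀)),
      ← sum_negMulLog_const_mul α _ ((sum_law _ _).trans (sum_channelLaw hp hW₁))]
    simp only [law_channelLaw_output, mixChannel, Sum.elim_inl, Sum.elim_inr, Finset.mul_sum,
      mul_left_comm]
  have h2 : entropy (channelLaw p (mixChannel α W₀ W₁)) (fun t => (f t.1, t.2)) =
      ((1 - α) * entropy (channelLaw p W₀) (fun t => (f t.1, t.2)) + Real.negMulLog (1 - α)) +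
      (α * entropy (channelLaw p W₁) (fun t => (f t.1, t.2)) + Real.negMulLog α) := by
    unfold entropy
    rw [← sum_negMulLog_const_mul (1 - α) _ ((sum_law _ _).trans (sum_channelLaw hp hW₀)),
      ← sum_negMulLog_const_mul α _ ((sum_law _ _).trans (sum_channelLaw hp hW₁))]
    simp only [Fintype.sum_prod_type, Fintype.sum_sum_type, Finset.sum_add_distrib,
      law_channelLaw_pair, mixChannel, Sum.elim_inl, Sum.elim_inr, Finset.mul_sum, mul_left_comm,
      mul_ite, mul_zero]
  rw [mutualInfo, mutualInfo, mutualInfo, h1, h2, entropy_channelLaw_input p hW,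
    entropy_channelLaw_input p hW₀, entropy_channelLaw_input p hW₁]
  ring

open Classical in
/-- The channel that discloses the random variable `g`. -/
noncomputable def discloseChannel (g : Ω → D) (ω : Ω) : D → ℝ := Pi.single (g ω) 1

omit [Fintype Ω] in
lemma discloseChannel_mem_stdSimplex (g : Ω → D) (ω : Ω) :
    discloseChannel g ω ∈ stdSimplex ℝ D := by
  classical
  exact single_mem_stdSimplex ℝ (g ω)

lemma mutualInfo_discloseChannel (p : Ω → ℝ) (f : Ω → A) (g : Ω → D) :
    mutualInfo (channelLaw p (discloseChannel g)) (fun t => f t.1) (fun t => t.2) =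
      mutualInfo p f g := by
  classical
  have h1 : law (channelLaw p (discloseChannel g)) (fun t => t.2) = law p g := by
    funext d
    rw [law_channelLaw_output]
    simp [discloseChannel, law, Pi.single_apply, eq_comm]
  have h2 : law (channelLaw p (discloseChannel g)) (fun t => (f t.1, t.2)) =
      law p fun ω => (f ω, g ω) := by
    funext ⟨a, d⟩
    rw [law_channelLaw_pair]
    simp only [law, discloseChannel, Pi.single_apply, Prod.mk.injEq, mul_ite, mul_one, mul_zero,
      ite_and, eq_comm]
  rw [mutualInfo, mutualInfo,
    entropy_channelLaw_input p fun ω => (discloseChannel_mem_stdSimplex g ω).2]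
  simp only [entropy, h1, h2]

end Channel

/-! ### A single pair of private and useful data -/

section Pair

universe u v

variable {A : Type u} {B : Type v} [Fintype A] [Fintype B]

lemma law_fst (p : A × B → ℝ) (a : A) : law p Prod.fst a = ∑ b, p (a, b) := by
  classical
  rw [law, Fintype.sum_prod_type, Finset.sum_comm]
  simp

lemma mutualInfo_eq_sum_log (p : A × B → ℝ) :
    mutualInfo p Prod.fst Prod.snd =
      ∑ z, p z * (Real.log (p z) - Real.log (law p Prod.fst z.1) -
        Real.log (law p Prod.snd z.2)) := by
  have h : law p (fun z => (z.1, z.2)) = p := law_id p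
  rw [mutualInfo, entropy_eq_sum, entropy_eq_sum, entropy_eq_sum]
  simp only [h, mul_sub, Finset.sum_sub_distrib]
  ring

/-- The private datum is independent of the output if the joint law factors. -/
lemma mutualInfo_eq_zero {C : Type*} [Fintype C] {p : A × B → ℝ} (hp : p ∈ stdSimplex ℝ (A × B))
    {W : A × B → C → ℝ} (hW : ∀ z, ∑ c, W z c = 1) {q : C → ℝ}
    (h : ∀ a c, ∑ b, p (a, b) * W (a, b) c = law p Prod.fst a * q c) :
    mutualInfo (channelLaw p W) (fun t => t.1.1) (fun t => t.2) = 0 := by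
  classical
  have hs : ∑ a, law p Prod.fst a = 1 := (sum_law _ _).trans hp.2
  have hU : ∀ c, law (channelLaw p W) (fun t => t.2) c = q c := fun c => by
    rw [law_channelLaw_output, Fintype.sum_prod_type, Finset.sum_congr rfl fun a _ => h a c,
      ← Finset.sum_mul, hs, one_mul]
  have hq : ∑ c, q c = 1 := by
    rw [← Finset.sum_congr rfl fun c _ => hU c, sum_law, sum_channelLaw hp.2 hW]
  have hAU : ∀ a c, law (channelLaw p W) (fun t => (t.1.1, t.2)) (a, c) =
      law p Prod.fst a * q c := fun a c => by
    rw [law_channelLaw_pair p W Prod.fst, ← h, Fintype.sum_prod_type, Finset.sum_comm]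
    simp
  rw [mutualInfo, entropy_channelLaw_input p hW fun z => z.1]
  simp only [entropy, Fintype.sum_prod_type, hU, hAU, sum_negMulLog_const_mul _ q hq,
    Finset.sum_add_distrib, ← Finset.sum_mul, hs]
  ring

lemma log_add_two_add_log_two_le {x : ℝ} (hx : 0 ≤ x) :
    Real.log (1 + (x + (1 + Real.log 2))) ≤ 1 + Real.log (x + 1) := by
  have h1 := Real.log_two_lt_d9
  have h2 := Real.exp_one_gt_d9
  have h3 := Real.log_pos one_lt_two
  have h4 : 0 < 1 + (x + (1 + Real.log 2)) := by linarith
  calc Real.log (1 + (x + (1 + Real.log 2))) ≤ Real.log (Real.exp 1 * (x + 1)) :=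
        Real.log_le_log h4 (by nlinarith)
    _ = 1 + Real.log (x + 1) := by
        rw [Real.log_mul (Real.exp_pos 1).ne' (by positivity), Real.log_exp]

/-- A strong functional representation with a finite alphabet: there is an output which is
independent of the private datum, and given which the useful datum has an entropy of at most
`I + log (I + 1) + 4`, where `I` is the mutual information of the two data. -/
lemma exists_private_channel {p : A × B → ℝ} (hp : p ∈ stdSimplex ℝ (A × B)) :
    ∃ (C : Type v) (_ : Fintype C) (W : A × B → C → ℝ), (∀ z, W z ∈ stdSimplex ℝ C) ∧
      mutualInfo (channelLaw p W) (fun t => t.1.1) (fun t => t.2) = 0 ∧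
      condEntropy (channelLaw p W) (fun t => t.1.2) (fun t => t.2) ≤
        mutualInfo p Prod.fst Prod.snd + (Real.log (mutualInfo p Prod.fst Prod.snd + 1) + 4) := by
  classical
  set I := mutualInfo p Prod.fst Prod.snd with hI
  have hI0 : 0 ≤ I := mutualInfo_nonneg hp _ _
  set Q : B → ℝ := law p Prod.snd with hQdef
  have hQ : Q ∈ stdSimplex ℝ B := law_mem_stdSimplex hp _
  set α : A → ℝ := law p Prod.fst with hα
  have hα0 : ∀ a, 0 ≤ α a := law_nonneg hp.1 _
  have hα1 : ∑ a, α a = 1 := (sum_law _ _).trans hp.2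
  have hpQ : ∀ a b, Q b = 0 → p (a, b) = 0 := fun a b h =>
    le_antisymm (h ▸ le_law hp.1 Prod.snd (a, b)) (hp.1 _)
  -- `R a` is the conditional law of the useful datum, dominated by `Q` also where `α a = 0`.
  choose R hR hpR hRQ using fun a => exists_conditional (fun b => hp.1 (a, b)) hQ
  simp only [← law_fst, ← hα] at hpR
  have hac : ∀ a b, Q b = 0 → R a b = 0 := fun a b h => hRQ a b h (hpQ a b h)
  set M : ℝ := ∑ z : A × B, R z.1 z.2 / Q z.2 with hM
  have hM0 : ∀ z : A × B, 0 ≤ R z.1 z.2 / Q z.2 := fun z => div_nonneg ((hR _).1 _) (hQ.1 _)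
  have hM1 : 0 ≤ M := Finset.sum_nonneg fun z _ => hM0 z
  have hRM : ∀ a b, R a b ≤ M * Q b := fun a b => by
    rcases (hQ.1 b).eq_or_lt with h | h
    · rw [hac a b h.symm, ← h, mul_zero]
    · rw [← div_le_iff₀ h]
      exact Finset.single_le_sum (f := fun z : A × B => R z.1 z.2 / Q z.2) (fun z _ => hM0 z)
        (Finset.mem_univ (a, b))
  set c := Real.log (Fintype.card B) with hc
  have hc0 : 0 ≤ c := Real.log_natCast_nonneg _
  have hlog2 : Real.log 2 < 1 := by have := Real.log_two_lt_d9; linarith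
  -- With `T` proposals a rejection of all of them costs at most `1 - log 2`.
  obtain ⟨T, hT⟩ := exists_nat_gt (M * c / (1 - Real.log 2))
  have hT0 : (0 : ℝ) < T := lt_of_le_of_lt (by have := sub_pos.2 hlog2; positivity) hT
  rw [div_lt_iff₀ (sub_pos.2 hlog2)] at hT
  have hrem : ∀ a, remaining Q (R a) T * c ≤ 1 - Real.log 2 := fun a => by
    have h1 := mul_le_mul_of_nonneg_right (mul_remaining_le hQ (hR a) hM1 (hRM a) T) hc0
    refine le_of_mul_le_mul_left ?_ hT0
    linarith
  choose J hJ0 hJQ hJR hJcost using fun a => exists_sampler hQ (hR a) (hac a) T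
  set q : (Fin T → B) → ℝ := fun u => ∏ j, Q (u j) with hq
  have hqs : q ∈ stdSimplex ℝ (Fin T → B) :=
    ⟨fun u => Finset.prod_nonneg fun _ _ => hQ.1 _, by
      rw [hq, sum_pi_prod fun (_ : Fin T) => Q]; simp [hQ.2]⟩
  choose W hW hJW _ using fun z : A × B =>
    exists_conditional (fun u => mul_nonneg (hα0 z.1) (hJ0 z.1 u z.2)) hqs
  have hpW : ∀ a b u, p (a, b) * W (a, b) u = α a * J a u b := fun a b u => by
    rw [hJW (a, b) u, ← Finset.mul_sum, hJR, hpR]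
  refine ⟨Fin T → B, inferInstance, W, hW, mutualInfo_eq_zero hp (fun z => (hW z).2) (q := q)
    fun a u => ?_, ?_⟩
  · rw [Finset.sum_congr rfl fun b _ => hpW a b u, ← Finset.mul_sum, hJQ]
  · set m := I + (1 + Real.log 2) with hm
    have hm0 : 0 < m := by have := Real.log_pos one_lt_two; positivity
    -- `θ = 1 / m` balances the two terms `θ * m` and `log (1 + 1 / θ)`.
    have hθ : 0 < 1 / m := by positivity
    refine (condEntropy_le_cross (channelLaw_mem_stdSimplex hp hW).1 (fun t => t.1.2)
      (fun t => t.2) (fun b u => code (1 / m) b u) (fun b u => (code_pos hθ b u).le)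
      (sum_code_le hθ) fun t _ => code_pos hθ _ _).trans ?_
    have h1 : -∑ t : (A × B) × (Fin T → B), channelLaw p W t * Real.log (code (1 / m) t.1.2 t.2) =
        ∑ a, α a * ∑ u, ∑ b, J a u b * -Real.log (code (1 / m) b u) := by
      simp only [channelLaw, Fintype.sum_prod_type, ← Finset.sum_neg_distrib, hpW, Finset.mul_sum]
      refine Finset.sum_congr rfl fun a _ => ?_
      rw [Finset.sum_comm]
      exact Finset.sum_congr rfl fun u _ => Finset.sum_congr rfl fun b _ => by ring
    have h2 : ∑ a, α a * ∑ b, R a b * Real.log (R a b / Q b) = I := by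
      rw [hI, mutualInfo_eq_sum_log, Fintype.sum_prod_type]
      refine Finset.sum_congr rfl fun a _ => ?_
      rw [Finset.mul_sum]
      refine Finset.sum_congr rfl fun b _ => ?_
      rw [← mul_assoc, ← hpR]
      rcases eq_or_ne (p (a, b)) 0 with h | h
      · simp [h]
      · have ha : α a ≠ 0 := fun h0 => h (by rw [hpR, h0, zero_mul])
        have hb : R a b ≠ 0 := fun h0 => h (by rw [hpR, h0, mul_zero])
        have hQb : Q b ≠ 0 := fun h0 => hb (hac a b h0)
        rw [Real.log_div hb hQb, hpR a b, Real.log_mul ha hb]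
        ring
    have h3 : ∀ a, α a * ∑ u, ∑ b, J a u b * -Real.log (code (1 / m) b u) ≤
        α a * ((1 + 1 / m) * (∑ b, R a b * Real.log (R a b / Q b) + (1 + Real.log 2)) +
          Real.log (1 + m) + (1 - Real.log 2)) := fun a => by
      refine mul_le_mul_of_nonneg_left ((hJcost a _ hθ).trans ?_) (hα0 a)
      rw [one_div_one_div]
      linarith [hrem a]
    rw [h1]
    refine (Finset.sum_le_sum fun a _ => h3 a).trans ?_
    have h4 : ∑ a, α a * ((1 + 1 / m) * (∑ b, R a b * Real.log (R a b / Q b) + (1 + Real.log 2)) +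
          Real.log (1 + m) + (1 - Real.log 2)) =
        (1 + 1 / m) * ∑ a, α a * ∑ b, R a b * Real.log (R a b / Q b) + (∑ a, α a) *
          ((1 + 1 / m) * (1 + Real.log 2) + Real.log (1 + m) + (1 - Real.log 2)) := by
      rw [Finset.mul_sum, Finset.sum_mul, ← Finset.sum_add_distrib]
      exact Finset.sum_congr rfl fun a _ => by ring
    have h5 : (1 + 1 / m) * m = m + 1 := by field_simp
    have h6 := log_add_two_add_log_two_le hI0
    rw [h4, h2, hα1]
    rw [hm, mul_add, ← hm] at h5
    linarith

/-- The two extreme channels, the private one and the one disclosing the useful datum, mixed such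
that the leakage is at most `e`. -/
lemma exists_channel {p : A × B → ℝ} (hp : p ∈ stdSimplex ℝ (A × B))
    (hH : 0 < entropy p Prod.fst) {e : ℝ} (he0 : 0 ≤ e) (he : e ≤ entropy p Prod.fst) :
    ∃ (C : Type v) (_ : Fintype C) (W : A × B → C → ℝ), (∀ z, W z ∈ stdSimplex ℝ C) ∧
      mutualInfo (channelLaw p W) (fun t => t.1.1) (fun t => t.2) ≤ e ∧
      condEntropy p Prod.snd Prod.fst - e / entropy p Prod.fst * condEntropy p Prod.fst Prod.snd + e
          - (1 - e / entropy p Prod.fst) * (Real.log (mutualInfo p Prod.fst Prod.snd + 1) + 4) ≤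
        mutualInfo (channelLaw p W) (fun t => t.1.2) (fun t => t.2) := by
  obtain ⟨C, _, W, hW, h0, h1⟩ := exists_private_channel hp
  set α := e / entropy p Prod.fst with hα
  have hα0 : 0 ≤ α := by positivity
  have hα1 : α ≤ 1 := (div_le_one hH).2 he
  have hαe : α * entropy p Prod.fst = e := div_mul_cancel₀ _ hH.ne'
  have hswap : entropy p (fun z => (z.2, z.1)) = entropy p fun z => (z.1, z.2) :=
    entropy_comp_injective p (fun z => (z.1, z.2)) (g := Prod.swap) Prod.swap_injective
  refine ⟨C ⊕ B, inferInstance, mixChannel α W (discloseChannel Prod.snd),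
    mixChannel_mem_stdSimplex hα0 hα1 hW fun z => discloseChannel_mem_stdSimplex _ z, ?_, ?_⟩
  · rw [mutualInfo_mixChannel hp.2 α (fun z => (hW z).2)
      (fun z => (discloseChannel_mem_stdSimplex (D := B) Prod.snd z).2) fun z => z.1, h0,
      mutualInfo_discloseChannel p (fun z => z.1) Prod.snd, mul_zero, zero_add]
    exact (mul_le_mul_of_nonneg_left (mutualInfo_le_entropy_left hp.1 _ _) hα0).trans_eq hαe
  · rw [mutualInfo_mixChannel hp.2 α (fun z => (hW z).2)
      (fun z => (discloseChannel_mem_stdSimplex (D := B) Prod.snd z).2) fun z => z.2,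
      mutualInfo_discloseChannel p (fun z => z.2) Prod.snd]
    have h2 := mutualInfo_self p (Prod.snd : A × B → B)
    have h3 : mutualInfo (channelLaw p W) (fun t => t.1.2) (fun t => t.2) =
        entropy p Prod.snd - condEntropy (channelLaw p W) (fun t => t.1.2) (fun t => t.2) := by
      rw [mutualInfo, condEntropy, entropy_channelLaw_input p (fun z => (hW z).2) fun z => z.2]
      ring
    have h4 := mul_le_mul_of_nonneg_left h1 (sub_nonneg.2 hα1)
    rw [h3, h2]
    simp only [condEntropy, mutualInfo] at h4 ⊢
    rw [hswap]
    linarith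

end Pair

/-! ### Independent pairs -/

section Problem

universe u v

variable {N K : ℕ} {𝒳 : Fin N → Type u} {𝒴 : Fin N → Type v} [∀ i, Fintype (𝒳 i)]
  [∀ i, Fintype (𝒴 i)]

/-- The law of the pair `(X_i, Y_i)`. -/
noncomputable abbrev pairLaw (P : ((i : Fin N) → 𝒳 i) × ((i : Fin N) → 𝒴 i) → ℝ) (i : Fin N) :
    𝒳 i × 𝒴 i → ℝ := law P fun ω => (coordX i ω, coordY i ω)

/-- Regrouping of a sample point `((x, y), u)` of all data and of an output vector into the
components `((x_i, y_i), u_i)`. -/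
def regroup {n : ℕ} {C : Fin N → Type*} (enum : (∀ i, C i) ≃ Fin n) :
    (((i : Fin N) → 𝒳 i) × ((i : Fin N) → 𝒴 i)) × Fin n ≃ ∀ i, (𝒳 i × 𝒴 i) × C i where
  toFun t i := ((t.1.1 i, t.1.2 i), enum.symm t.2 i)
  invFun z := ((fun i => (z i).1.1, fun i => (z i).1.2), enum fun i => (z i).2)
  left_inv t := by simp
  right_inv z := by simp

/-- Separate channels for the components, used side by side. -/
noncomputable def productChannel {n : ℕ} {C : Fin N → Type*} (enum : (∀ i, C i) ≃ Fin n)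
    (W : ∀ i, 𝒳 i × 𝒴 i → C i → ℝ) (ω : ((i : Fin N) → 𝒳 i) × ((i : Fin N) → 𝒴 i)) (k : Fin n) :
    ℝ := ∏ i, W i (ω.1 i, ω.2 i) (enum.symm k i)

section Product

variable {n : ℕ} {C : Fin N → Type*} [∀ i, Fintype (C i)] (enum : (∀ i, C i) ≃ Fin n)
  {W : ∀ i, 𝒳 i × 𝒴 i → C i → ℝ} {P : ((i : Fin N) → 𝒳 i) × ((i : Fin N) → 𝒴 i) → ℝ}

omit [∀ i, Fintype (𝒳 i)] [∀ i, Fintype (𝒴 i)] in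
lemma productChannel_mem_stdSimplex (hW : ∀ i z, W i z ∈ stdSimplex ℝ (C i))
    (ω : ((i : Fin N) → 𝒳 i) × ((i : Fin N) → 𝒴 i)) :
    productChannel enum W ω ∈ stdSimplex ℝ (Fin n) := by
  refine ⟨fun k => Finset.prod_nonneg fun i _ => (hW i _).1 _, ?_⟩
  simp only [productChannel]
  rw [enum.symm.sum_comp fun u : ∀ i, C i => ∏ i, W i (ω.1 i, ω.2 i) (u i),
    sum_pi_prod fun i => W i (ω.1 i, ω.2 i)]
  exact Finset.prod_eq_one fun i _ => (hW i _).2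

omit [∀ i, Fintype (C i)] in
lemma jointLaw_productChannel (hindep : IndepPairs P) :
    jointLaw P (productChannel enum W) =
      fun t => ∏ i, channelLaw (pairLaw P i) (W i) (regroup enum t i) := by
  funext ⟨⟨x, y⟩, k⟩
  simp only [jointLaw, productChannel, channelLaw, regroup, hindep x y, Equiv.coe_fn_mk,
    Finset.prod_mul_distrib]

variable (hP : P ∈ stdSimplex ℝ (((i : Fin N) → 𝒳 i) × ((i : Fin N) → 𝒴 i)))
  (hindep : IndepPairs P) (hW : ∀ i z, W i z ∈ stdSimplex ℝ (C i))

include hP hindep hW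

lemma mutualInfo_productChannel {D : Fin N → Type*} [∀ i, Fintype (D i)]
    (f : ∀ i, (𝒳 i × 𝒴 i) × C i → D i) :
    mutualInfo (jointLaw P (productChannel enum W)) (fun t i => f i (regroup enum t i))
      (fun t => t.2) =
      ∑ i, mutualInfo (channelLaw (pairLaw P i) (W i)) (f i) (fun t => t.2) := by
  have hs : ∀ i, ∑ t, channelLaw (pairLaw P i) (W i) t = 1 := fun i =>
    sum_channelLaw (law_mem_stdSimplex hP _).2 fun z => (hW i z).2
  have h1 := mutualInfo_comp_injective (jointLaw P (productChannel enum W))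
    (fun t i => f i (regroup enum t i)) (fun t => t.2) Function.injective_id enum.symm.injective
  have h2 := mutualInfo_equiv (regroup enum)
    (fun z : ∀ i, (𝒳 i × 𝒴 i) × C i => ∏ i, channelLaw (pairLaw P i) (W i) (z i))
    (fun z i => f i (z i)) (fun z i => (z i).2)
  rw [mutualInfo_pi _ hs f fun i t => t.2] at h2
  rw [← h1, ← h2, jointLaw_productChannel enum hindep]
  rfl

lemma leakage_productChannel :
    leakage P (productChannel enum W) =
      ∑ i, mutualInfo (channelLaw (pairLaw P i) (W i)) (fun t => t.1.1) (fun t => t.2) :=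
  mutualInfo_productChannel enum hP hindep hW fun _ t => t.1.1

lemma mutualInfo_subvector_productChannel (s : Finset (Fin N)) :
    mutualInfo (jointLaw P (productChannel enum W)) (fun t => subvector s t.1) (fun t => t.2) =
      ∑ i with i ∈ s, mutualInfo (channelLaw (pairLaw P i) (W i)) (fun t => t.1.2)
        (fun t => t.2) := by
  -- The sub-vector is padded with `none` outside `s`, so that it has independent components.
  have hpad : Function.Injective fun (c : (i : {i // i ∈ s}) → 𝒴 i.1) (i : Fin N) =>
      if h : i ∈ s then some (c ⟨i, h⟩) else none := fun c c' h => by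
    funext ⟨i, hi⟩
    simpa [hi] using congrFun h i
  rw [← mutualInfo_comp_injective (jointLaw P (productChannel enum W))
    (fun t => subvector s t.1) (fun t => t.2) hpad Function.injective_id]
  have hf : (fun (t : (((i : Fin N) → 𝒳 i) × ((i : Fin N) → 𝒴 i)) × Fin n) (i : Fin N) =>
      if h : i ∈ s then some (subvector s t.1 ⟨i, h⟩) else none) =
      fun t i => if i ∈ s then some (regroup enum t i).1.2 else none := by
    funext t i
    by_cases h : i ∈ s <;> simp [h, subvector, regroup]
  rw [hf]
  refine (mutualInfo_productChannel enum hP hindep hW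
    fun i t => if i ∈ s then some t.1.2 else none).trans ?_
  rw [Finset.sum_filter]
  refine Finset.sum_congr rfl fun i _ => ?_
  by_cases h : i ∈ s
  · simp only [h, if_true]
    exact mutualInfo_comp_injective (channelLaw (pairLaw P i) (W i))
      (fun t : (𝒳 i × 𝒴 i) × C i => t.1.2) (fun t => t.2) (h := some) (k := id)
      (Option.some_injective _) Function.injective_id
  · simp only [h, if_false]
    exact mutualInfo_const_left _
      (sum_channelLaw (law_mem_stdSimplex hP _).2 fun z => (hW i z).2) _ _

lemma utility_productChannel (S : Fin K → Finset (Fin N)) (lam : Fin K → ℝ) :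
    utility P S lam (productChannel enum W) = ∑ i, weight S lam i *
      mutualInfo (channelLaw (pairLaw P i) (W i)) (fun t => t.1.2) (fun t => t.2) := by
  simp only [utility, mutualInfo_subvector_productChannel enum hP hindep hW, weight,
    Finset.sum_filter, Finset.sum_mul, Finset.mul_sum, mul_ite, ite_mul, mul_zero, zero_mul]
  exact Finset.sum_comm

end Product

variable {P : ((i : Fin N) → 𝒳 i) × ((i : Fin N) → 𝒴 i) → ℝ}
  {S : Fin K → Finset (Fin N)} {lam : Fin K → ℝ} {ε : ℝ}

lemma weight_nonneg (hlam : ∀ j, 0 ≤ lam j) (i : Fin N) : 0 ≤ weight S lam i :=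
  Finset.sum_nonneg fun j _ => hlam j

lemma utility_le (hP : P ∈ stdSimplex ℝ (((i : Fin N) → 𝒳 i) × ((i : Fin N) → 𝒴 i)))
    (hlam : ∀ j, 0 ≤ lam j) {n : ℕ} {W : ((i : Fin N) → 𝒳 i) × ((i : Fin N) → 𝒴 i) → Fin n → ℝ}
    (hW : ∀ ω, W ω ∈ stdSimplex ℝ (Fin n)) :
    utility P S lam W ≤ ∑ j, lam j * entropy P (subvector (S j)) := by
  refine Finset.sum_le_sum fun j _ => mul_le_mul_of_nonneg_left ?_ (hlam j)
  refine (mutualInfo_le_entropy_left (channelLaw_mem_stdSimplex hP hW).1 _ _).trans_eq ?_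
  exact entropy_channelLaw_input P (fun ω => (hW ω).2) (subvector (S j))

/-- Every proper allocation of the leakage is achieved by separate channels for the pairs. -/
lemma objective_le_privacyUtility
    (hP : P ∈ stdSimplex ℝ (((i : Fin N) → 𝒳 i) × ((i : Fin N) → 𝒴 i)))
    (hindep : IndepPairs P) (hH : ∀ i, 0 < entropy P (coordX i)) (hlam : ∀ j, 0 ≤ lam j)
    {e : Fin N → ℝ} (he : e ∈ properAllocations P ε) :
    objective P S lam e ≤ privacyUtility P S lam ε := by
  obtain ⟨⟨he0, hes⟩, heH⟩ := he
  have hX : ∀ i, entropy (pairLaw P i) Prod.fst = entropy P (coordX i) := fun i =>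
    (entropy_comp P (fun ω => (coordX i ω, coordY i ω)) Prod.fst).symm
  have hY : ∀ i, entropy (pairLaw P i) Prod.snd = entropy P (coordY i) := fun i =>
    (entropy_comp P (fun ω => (coordX i ω, coordY i ω)) Prod.snd).symm
  have hI : ∀ i, mutualInfo (pairLaw P i) Prod.fst Prod.snd =
      mutualInfo P (coordX i) (coordY i) := fun i =>
    (mutualInfo_comp P (fun ω => (coordX i ω, coordY i ω)) Prod.fst Prod.snd).symm
  have hXY : ∀ i, condEntropy (pairLaw P i) Prod.fst Prod.snd =
      condEntropy P (coordX i) (coordY i) := fun i => by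
    rw [condEntropy, condEntropy, hY]
    exact congrArg (· - _) (entropy_comp P (fun ω => (coordX i ω, coordY i ω))
      fun z => (z.1, z.2)).symm
  have hYX : ∀ i, condEntropy (pairLaw P i) Prod.snd Prod.fst =
      condEntropy P (coordY i) (coordX i) := fun i => by
    rw [condEntropy, condEntropy, hX]
    exact congrArg (· - _) (entropy_comp P (fun ω => (coordX i ω, coordY i ω))
      fun z => (z.2, z.1)).symm
  choose C _ W hW hleak hutil using fun i => exists_channel
    (law_mem_stdSimplex hP fun ω => (coordX i ω, coordY i ω)) ((hX i).symm ▸ hH i) (he0 i).1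
    ((hX i).symm ▸ heH i)
  let enum := Fintype.equivFin (∀ i, C i)
  have hle : utility P S lam (productChannel enum W) ≤ privacyUtility P S lam ε := by
    refine le_csSup ⟨∑ j, lam j * entropy P (subvector (S j)), ?_⟩
      ⟨_, productChannel enum W, productChannel_mem_stdSimplex enum hW, ?_, rfl⟩
    · rintro _ ⟨n, V, hV, -, rfl⟩
      exact utility_le hP hlam hV
    · rw [leakage_productChannel enum hP hindep hW]
      exact (Finset.sum_le_sum fun i _ => hleak i).trans hes
  refine le_trans ?_ hle
  rw [utility_productChannel enum hP hindep hW]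
  refine Finset.sum_le_sum fun i _ => mul_le_mul_of_nonneg_left ?_ (weight_nonneg hlam i)
  have := hutil i
  rwa [hX, hXY, hYX, hI] at this

/-! ### The linear program -/

lemma objective_eq (hH : ∀ i, 0 < entropy P (coordX i)) (e : Fin N → ℝ) :
    objective P S lam e = constTerm P S lam + ∑ i, weight S lam i * gamma P i * e i := by
  rw [objective, constTerm, ← Finset.sum_add_distrib]
  refine Finset.sum_congr rfl fun i _ => ?_
  have := (hH i).ne'
  rw [beta, gamma, alpha]
  field_simp
  ring

lemma gamma_nonneg (hP : P ∈ stdSimplex ℝ (((i : Fin N) → 𝒳 i) × ((i : Fin N) → 𝒴 i)))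
    {i : Fin N} (hH : 0 < entropy P (coordX i)) : 0 ≤ gamma P i := by
  have h1 := mutualInfo_nonneg hP (coordX i) (coordY i)
  have h2 : condEntropy P (coordX i) (coordY i) ≤ entropy P (coordX i) := by
    rw [mutualInfo] at h1
    rw [condEntropy]
    linarith
  have h3 : 0 ≤ excess P i := add_nonneg (Real.log_nonneg (by linarith)) (by norm_num)
  exact add_nonneg (sub_nonneg.2 ((div_le_one hH).2 h2)) (by positivity)

lemma le_maxCoeff (i : Fin N) : weight S lam i * gamma P i ≤ maxCoeff P S lam :=
  le_ciSup (f := fun i => weight S lam i * gamma P i) (Set.finite_range _).bddAbove i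

lemma maxCoeff_nonneg (hP : P ∈ stdSimplex ℝ (((i : Fin N) → 𝒳 i) × ((i : Fin N) → 𝒴 i)))
    (hH : ∀ i, 0 < entropy P (coordX i)) (hlam : ∀ j, 0 ≤ lam j) : 0 ≤ maxCoeff P S lam :=
  Real.iSup_nonneg fun i => mul_nonneg (weight_nonneg hlam i) (gamma_nonneg hP (hH i))

lemma objective_le_lowerBound
    (hP : P ∈ stdSimplex ℝ (((i : Fin N) → 𝒳 i) × ((i : Fin N) → 𝒴 i)))
    (hH : ∀ i, 0 < entropy P (coordX i)) (hlam : ∀ j, 0 ≤ lam j) {e : Fin N → ℝ}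
    (he : e ∈ allocations N ε) : objective P S lam e ≤ lowerBound P S lam ε := by
  rw [objective_eq hH, lowerBound]
  refine add_le_add le_rfl ?_
  calc ∑ i, weight S lam i * gamma P i * e i ≤ ∑ i, maxCoeff P S lam * e i :=
        Finset.sum_le_sum fun i _ => mul_le_mul_of_nonneg_right (le_maxCoeff i) (he.1 i).1
    _ = maxCoeff P S lam * ∑ i, e i := by rw [Finset.mul_sum]
    _ ≤ maxCoeff P S lam * ε := mul_le_mul_of_nonneg_left he.2 (maxCoeff_nonneg hP hH hlam)

/-- An allocation of the whole leakage to components with the largest coefficient is optimal. -/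
lemma objective_eq_lowerBound (hH : ∀ i, 0 < entropy P (coordX i)) {e : Fin N → ℝ}
    (hsum : ∑ i, e i = ε)
    (hsupp : ∀ i, weight S lam i * gamma P i ≠ maxCoeff P S lam → e i = 0) :
    objective P S lam e = lowerBound P S lam ε := by
  rw [objective_eq hH, lowerBound, ← hsum, Finset.mul_sum]
  congr 1
  refine Finset.sum_congr rfl fun i _ => ?_
  by_cases h : weight S lam i * gamma P i = maxCoeff P S lam
  · rw [h]
  · rw [hsupp i h, mul_zero, mul_zero]

lemma mem_allocations {e : Fin N → ℝ} (h0 : ∀ i, 0 ≤ e i) (hsum : ∑ i, e i = ε) :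
    e ∈ allocations N ε :=
  ⟨fun i => ⟨h0 i, hsum ▸ Finset.single_le_sum (fun i _ => h0 i) (Finset.mem_univ i)⟩, hsum.le⟩

lemma sSup_objective_allocations [Nonempty (Fin N)]
    (hP : P ∈ stdSimplex ℝ (((i : Fin N) → 𝒳 i) × ((i : Fin N) → 𝒴 i)))
    (hH : ∀ i, 0 < entropy P (coordX i)) (hlam : ∀ j, 0 ≤ lam j) (hε : 0 ≤ ε) :
    sSup (objective P S lam '' allocations N ε) = lowerBound P S lam ε := by
  obtain ⟨m, hm⟩ := exists_eq_ciSup_of_finite (f := fun i => weight S lam i * gamma P i)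
  refine IsGreatest.csSup_eq ⟨⟨Pi.single m ε, mem_allocations (fun i => ?_) (by simp), ?_⟩, ?_⟩
  · by_cases h : i = m <;> simp [h, hε]
  · refine objective_eq_lowerBound hH (by simp) fun i hi => ?_
    rw [Pi.single_eq_of_ne]
    rintro rfl
    exact hi hm
  · rintro _ ⟨e, he, rfl⟩
    exact objective_le_lowerBound hP hH hlam he

/-- If the entropies of the components with the largest coefficient can absorb the leakage, then
its allocation in proportion to these entropies is proper. -/
lemma sSup_objective_properAllocations [Nonempty (Fin N)]
    (hP : P ∈ stdSimplex ℝ (((i : Fin N) → 𝒳 i) × ((i : Fin N) → 𝒴 i)))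
    (hH : ∀ i, 0 < entropy P (coordX i)) (hlam : ∀ j, 0 ≤ lam j) (hε : 0 ≤ ε)
    (habs : ε ≤ ∑ i with weight S lam i * gamma P i = maxCoeff P S lam, entropy P (coordX i)) :
    sSup (objective P S lam '' properAllocations P ε) = lowerBound P S lam ε := by
  obtain ⟨m, hm⟩ := exists_eq_ciSup_of_finite (f := fun i => weight S lam i * gamma P i)
  set M : Finset (Fin N) :=
    Finset.univ.filter fun i => weight S lam i * gamma P i = maxCoeff P S lam with hM
  set h := ∑ i ∈ M, entropy P (coordX i) with hh
  have hpos : 0 < h := Finset.sum_pos (fun i _ => hH i) ⟨m, by simp [hM, maxCoeff, ← hm]⟩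
  set e : Fin N → ℝ := fun i => if i ∈ M then entropy P (coordX i) * (ε / h) else 0 with he
  have he0 : ∀ i, 0 ≤ e i := fun i => by
    have := (hH i).le
    simp only [he]
    split_ifs <;> positivity
  have hsum : ∑ i, e i = ε := by
    simp only [he, Finset.sum_ite_mem, Finset.univ_inter]
    rw [← Finset.sum_mul, ← hh, mul_div_cancel₀ _ hpos.ne']
  refine IsGreatest.csSup_eq ⟨⟨e, ⟨mem_allocations he0 hsum, fun i => ?_⟩, ?_⟩, ?_⟩
  · have h1 : ε / h ≤ 1 := (div_le_one hpos).2 habs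
    simp only [he]
    split_ifs
    exacts [mul_le_of_le_one_right (hH i).le h1, (hH i).le]
  · exact objective_eq_lowerBound hH hsum fun i hi => if_neg (by simpa [hM] using hi)
  · rintro _ ⟨e, he, rfl⟩
    exact objective_le_lowerBound hP hH hlam he.1

lemma sSup_objective_le_privacyUtility
    (hP : P ∈ stdSimplex ℝ (((i : Fin N) → 𝒳 i) × ((i : Fin N) → 𝒴 i)))
    (hindep : IndepPairs P) (hH : ∀ i, 0 < entropy P (coordX i)) (hlam : ∀ j, 0 ≤ lam j)
    (hε : 0 ≤ ε) :
    sSup (objective P S lam '' properAllocations P ε) ≤ privacyUtility P S lam ε := by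
  refine csSup_le ⟨_, 0, ⟨⟨fun i => ⟨le_rfl, hε⟩, by simpa using hε⟩, fun i => (hH i).le⟩, rfl⟩ ?_
  rintro _ ⟨e, he, rfl⟩
  exact objective_le_privacyUtility hP hindep hH hlam he

/-- Without components there is no mutual information, so that `ε < I(X ; Y)` is impossible. -/
lemma nonempty_of_lt_mutualInfo
    (hP : P ∈ stdSimplex ℝ (((i : Fin N) → 𝒳 i) × ((i : Fin N) → 𝒴 i))) (hε0 : 0 ≤ ε)
    (hε : ε < mutualInfo P (fun ω => ω.1) (fun ω => ω.2)) : Nonempty (Fin N) := by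
  by_contra hN
  rw [not_nonempty_iff] at hN
  have h : (fun ω : ((i : Fin N) → 𝒳 i) × ((i : Fin N) → 𝒴 i) => ω.1) = fun _ => isEmptyElim :=
    funext fun ω => Subsingleton.elim _ _
  rw [h, mutualInfo_const_left P hP.2] at hε
  exact hε.not_ge hε0

end Problem

end PrivacyUtility

theorem lemma7 {N K : ℕ} {𝒳 𝒴 : Fin N → Type*} [∀ i, Fintype (𝒳 i)] [∀ i, Fintype (𝒴 i)]
    (P : ((i : Fin N) → 𝒳 i) × ((i : Fin N) → 𝒴 i) → ℝ)
    (hP : P ∈ stdSimplex ℝ (((i : Fin N) → 𝒳 i) × ((i : Fin N) → 𝒴 i)))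
    (hindep : PrivacyUtility.IndepPairs P)
    (hH : ∀ i, 0 < PrivacyUtility.entropy P (PrivacyUtility.coordX i))
    (S : Fin K → Finset (Fin N)) (lam : Fin K → ℝ) (hlam : ∀ j, 0 ≤ lam j)
    (ε : ℝ) (hε0 : 0 ≤ ε)
    (hε : ε < PrivacyUtility.mutualInfo P (fun ω => ω.1) (fun ω => ω.2)) :
    -- the lower bound on the privacy-utility trade-off
    sSup (PrivacyUtility.objective P S lam '' PrivacyUtility.properAllocations P ε)
        ≤ PrivacyUtility.privacyUtility P S lam ε ∧
    -- the objective is affine in the allocation: the right-hand side is a linear program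
    (∀ e : Fin N → ℝ, PrivacyUtility.objective P S lam e =
      PrivacyUtility.constTerm P S lam
        + ∑ i, PrivacyUtility.weight S lam i * PrivacyUtility.gamma P i * e i) ∧
    -- the value of the linear program
    sSup (PrivacyUtility.objective P S lam '' PrivacyUtility.allocations N ε)
        = PrivacyUtility.lowerBound P S lam ε ∧
    -- the two suprema agree, and the value is a lower bound, when the entropies of the private
    -- components with the largest coefficient can absorb the whole leakage `ε`
    (ε ≤ ∑ i with PrivacyUtility.weight S lam i * PrivacyUtility.gamma P i
            = PrivacyUtility.maxCoeff P S lam,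
          PrivacyUtility.entropy P (PrivacyUtility.coordX i) →
      sSup (PrivacyUtility.objective P S lam '' PrivacyUtility.properAllocations P ε)
          = sSup (PrivacyUtility.objective P S lam '' PrivacyUtility.allocations N ε) ∧
      sSup (PrivacyUtility.objective P S lam '' PrivacyUtility.allocations N ε)
          ≤ PrivacyUtility.privacyUtility P S lam ε) := by
  have := PrivacyUtility.nonempty_of_lt_mutualInfo hP hε0 hε
  have hlow := PrivacyUtility.sSup_objective_le_privacyUtility (S := S) hP hindep hH hlam hε0
  have hval := PrivacyUtility.sSup_objective_allocations (S := S) hP hH hlam hε0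
  refine ⟨hlow, PrivacyUtility.objective_eq hH, hval, fun habs => ?_⟩
  have heq := PrivacyUtility.sSup_objective_properAllocations hP hH hlam hε0 habs
  exact ⟨heq.trans hval.symm, (hval.trans heq.symm).trans_le hlow⟩
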